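/- A *category with fibrations* is a category with a terminal object and a class of maps, called fibrations, such that pullbacks of fibrations along arbitrary maps exist and are fibrations. A *trivial cofibration* is a map with the left lifting property with respect to all fibrations. A map $f : X \to Z$ is a *quasifibration* if it factors as a trivial cofibration $i : X \to Y$ followed by a fibration $p : Y \to Z$ such that for every map $Z' \to Z$ and pullbacks $Y' = Z' \times_Z Y$, $X' = Y' \times_Y X$, the induced map $X' \to Y'$ is a trivial cofibration. A map $f : X \to Y$ is *exponentiable* if pullbacks along $f$ exist and $f^* : \mathcal C/Y \to \mathcal C/X$ has a right adjoint. For a functor $F : \mathcal B \to \mathcal C$ of categories with fibrations, an *$F$-fibration* is a map of $\mathcal C$ that is a pullback of $F(f)$ for some fibration $f$ of $\mathcal B$. For a category with fibrations $\mathcal C$ and an object $X$, let $\mathcal C_!(X)$ be the contextual category whose contexts are finite lists of types over $X$; a type over a context with underlying object $\Delta$ is a diagram $\Delta \xrightarrow{r} V \xleftarrow{p} E$ with $p$ a fibration, the extended context has underlying object the (chosen) pullback $\Delta \times_V E$, morphisms of contexts are maps over $X$ of the underlying objects, and substitution is composition with $r$. Pulling lists back along maps $X' \to X$ makes $X \mapsto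 \mathcal C_!(X)$ a functor from $\mathcal C^{\mathrm{op}}$ to contextual categories; the contextual category $\mathcal C_!$ itself is $\mathcal C_!(1)$. For $F : \mathcal B \to \mathcal C$, the contextually indexed contextual category $F^*(\mathcal C_!)$ has base $\mathcal B_!$, and its contextual category over a context $\Gamma$ of $\mathcal B_!$ is $\mathcal C_!(F(\Gamma))$. A contextually indexed contextual category has *stable dependent coproducts* if the following rules, where $\Gamma$ is a base context and $\Delta$ an indexed context over it, can be interpreted in it, stably under reindexing (substitution of base terms) and under substitution of indexed terms: * formation: from $\Gamma, i : I \mid \Delta \vdash B_i$ (with $i$ not free in $\Delta$) infer $\Gamma \mid \Delta \vdash \coprod_{i:I} B_i$; * introduction: from $\Gamma \vdash j : I$ infer $\Gamma \mid \Delta, x : B_j \vdash \mathsf{in}_j(x) : \coprod_{i:I} B_i$; * elimination: from $\Gamma \mid \Delta, z : \coprod_{i:I} B_i \vdash D$ and $\Gamma, i : I \mid \Delta, x : B_i \vdash d : D[\mathsf{in}_i(x)/z]$ infer $\Gamma \mid \Delta, z : \coprod_{i:I} B_i \vdash \mathsf{elim}(z.D, i x.d) : D$; * computation: $\mathsf{elim}(z.D,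 i x.d)[\mathsf{in}_j(x)/z] = d[j/i]$. **Proposition.** Let $F : \mathcal B \to \mathcal C$ be a functor between categories with fibrations, where $\mathcal C$ has binary products. Suppose that 1. $F$ preserves pullbacks along fibrations, and pullbacks of $F$-fibrations exist; 2. fibrations of $\mathcal C$ and $F$-fibrations are exponentiable; 3. every composite $p \circ q$ of a fibration $q$ of $\mathcal C$ followed by an $F$-fibration $p$ is a quasifibration. Then $F^*(\mathcal C_!)$ has stable dependent coproducts. -/

import Mathlib

open CategoryTheory CategoryTheory.Limits

-- makes `X ⟶ Y` elaborate through `Category` rather than through reflexive quivers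
attribute [-instance] CategoryTheory.catToReflQuiver

universe v u w v₁ u₁ w₁ v₂ u₂ w₂ v₃ u₃ w₃

noncomputable section

namespace IndexedTT

/-! ### Contextual categories -/

/-- A contextual category: a category of contexts with types over contexts, context extension,
and strictly functorial substitution given by chosen pullback squares, in which every context is
obtained in a unique way from the empty (terminal) context by finitely many extensions. -/
structure ContextualCategory : Type (max (u + 1) (v + 1) (w + 1)) where
  /-- contexts -/
  Ctx : Type u
  [cat : Category.{v} Ctx]
  /-- types in a context -/
  Ty : Ctx → Type w
  /-- substitution `A[f]` -/
  sub : ∀ {Δ Γ : Ctx}, (Δ ⟶ Γ) → Ty Γ → Ty Δ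
  sub_id : ∀ {Γ : Ctx} (A : Ty Γ), sub (𝟙 Γ) A = A
  sub_comp : ∀ {Θ Δ Γ : Ctx} (g : Θ ⟶ Δ) (f : Δ ⟶ Γ) (A : Ty Γ),
    sub (g ≫ f) A = sub g (sub f A)
  /-- context extension `Γ.A` -/
  ext : ∀ (Γ : Ctx), Ty Γ → Ctx
  /-- the dependent projection `Γ.A ⟶ Γ` -/
  proj : ∀ {Γ : Ctx} (A : Ty Γ), ext Γ A ⟶ Γ
  /-- the canonical map `Δ.A[f] ⟶ Γ.A` over `f : Δ ⟶ Γ` -/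
  q : ∀ {Δ Γ : Ctx} (f : Δ ⟶ Γ) (A : Ty Γ), ext Δ (sub f A) ⟶ ext Γ A
  isPullback : ∀ {Δ Γ : Ctx} (f : Δ ⟶ Γ) (A : Ty Γ),
    IsPullback (q f A) (proj (sub f A)) (proj A) f
  q_id : ∀ {Γ : Ctx} (A : Ty Γ), q (𝟙 Γ) A = eqToHom (by rw [sub_id])
  q_comp : ∀ {Θ Δ Γ : Ctx} (g : Θ ⟶ Δ) (f : Δ ⟶ Γ) (A : Ty Γ),
    q (g ≫ f) A = eqToHom (by rw [sub_comp]) ≫ q g (sub f A) ≫ q f A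
  /-- the empty context -/
  empty : Ctx
  isTerminal : IsTerminal empty
  /-- the number of types in a context -/
  length : Ctx → ℕ
  length_ext : ∀ (Γ : Ctx) (A : Ty Γ), length (ext Γ A) = length Γ + 1
  length_eq_zero : ∀ (Γ : Ctx), length Γ = 0 ↔ Γ = empty
  existsUnique_ext : ∀ (Γ : Ctx), length Γ ≠ 0 → ∃! P : (Σ Δ : Ctx, Ty Δ), Γ = ext P.1 P.2

attribute [instance] ContextualCategory.cat

namespace ContextualCategory

variable {𝔹 : ContextualCategory.{v, u, w}}

theorem q_proj {Δ Γ : 𝔹.Ctx} (f : Δ ⟶ Γ) (A : 𝔹.Ty Γ) :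
    𝔹.q f A ≫ 𝔹.proj A = 𝔹.proj (𝔹.sub f A) ≫ f :=
  (𝔹.isPullback f A).w

/-- A term of type `A` in context `Γ`: a section of the dependent projection. -/
@[ext]
structure Tm {Γ : 𝔹.Ctx} (A : 𝔹.Ty Γ) : Type v where
  hom : Γ ⟶ 𝔹.ext Γ A
  hom_proj : hom ≫ 𝔹.proj A = 𝟙 Γ

/-- Substitution of terms: `a[f]` is the unique term of `A[f]` lying over `f ≫ a`. -/
def Tm.sub {Δ Γ : 𝔹.Ctx} (f : Δ ⟶ Γ) {A : 𝔹.Ty Γ} (a : Tm A) : Tm (𝔹.sub f A) where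
  hom := (𝔹.isPullback f A).lift (f ≫ a.hom) (𝟙 Δ) (by simp [a.hom_proj])
  hom_proj := by simp

theorem Tm.sub_q {Δ Γ : 𝔹.Ctx} (f : Δ ⟶ Γ) {A : 𝔹.Ty Γ} (a : Tm A) :
    (a.sub f).hom ≫ 𝔹.q f A = f ≫ a.hom := by
  simp [Tm.sub]

/-- The last variable of the context `Γ.A`, a term of the weakened type `A`. -/
def var {Γ : 𝔹.Ctx} (A : 𝔹.Ty Γ) : Tm (𝔹.sub (𝔹.proj A) A) where
  hom := (𝔹.isPullback (𝔹.proj A) A).lift (𝟙 _) (𝟙 _) (by simp)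
  hom_proj := by simp

theorem var_q {Γ : 𝔹.Ctx} (A : 𝔹.Ty Γ) : (var A).hom ≫ 𝔹.q (𝔹.proj A) A = 𝟙 _ := by
  simp [var]

end ContextualCategory

/-- A contextual functor: it strictly preserves the empty context, types, substitution, context
extension, projections, and the chosen pullback squares. -/
structure ContextualFunctor (𝔻 : ContextualCategory.{v₁, u₁, w₁})
    (𝔼 : ContextualCategory.{v₂, u₂, w₂}) where
  toFunctor : 𝔻.Ctx ⥤ 𝔼.Ctx
  mapTy : ∀ {Γ : 𝔻.Ctx}, 𝔻.Ty Γ → 𝔼.Ty (toFunctor.obj Γ)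
  obj_empty : toFunctor.obj 𝔻.empty = 𝔼.empty
  mapTy_sub : ∀ {Δ Γ : 𝔻.Ctx} (f : Δ ⟶ Γ) (A : 𝔻.Ty Γ),
    mapTy (𝔻.sub f A) = 𝔼.sub (toFunctor.map f) (mapTy A)
  obj_ext : ∀ {Γ : 𝔻.Ctx} (A : 𝔻.Ty Γ),
    toFunctor.obj (𝔻.ext Γ A) = 𝔼.ext (toFunctor.obj Γ) (mapTy A)
  map_proj : ∀ {Γ : 𝔻.Ctx} (A : 𝔻.Ty Γ),
    toFunctor.map (𝔻.proj A) = eqToHom (obj_ext A) ≫ 𝔼.proj (mapTy A)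
  map_q : ∀ {Δ Γ : 𝔻.Ctx} (f : Δ ⟶ Γ) (A : 𝔻.Ty Γ),
    toFunctor.map (𝔻.q f A) =
      eqToHom (by rw [obj_ext, mapTy_sub]) ≫ 𝔼.q (toFunctor.map f) (mapTy A) ≫
        eqToHom (obj_ext A).symm

namespace ContextualFunctor

variable {𝔻 : ContextualCategory.{v₁, u₁, w₁}} {𝔼 : ContextualCategory.{v₂, u₂, w₂}}
  {𝔽 : ContextualCategory.{v₃, u₃, w₃}}

theorem hext {G H : ContextualFunctor 𝔻 𝔼} (h : G.toFunctor = H.toFunctor)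
    (hty : ∀ {Γ : 𝔻.Ctx} (A : 𝔻.Ty Γ),
      𝔼.sub (eqToHom (by rw [h])) (H.mapTy A) = G.mapTy A) : G = H := by
  obtain ⟨G, Gt, _, _, _, _, _⟩ := G
  obtain ⟨H, Ht, _, _, _, _, _⟩ := H
  dsimp at h
  subst h
  have : @Gt = @Ht := by
    funext Γ A
    exact (hty A).symm.trans (𝔼.sub_id _)
  subst this
  rfl

theorem mapTy_congr {G H : ContextualFunctor 𝔻 𝔼} (h : G = H) {Γ : 𝔻.Ctx} (A : 𝔻.Ty Γ) :
    𝔼.sub (eqToHom (by rw [h])) (H.mapTy A) = G.mapTy A := by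
  subst h
  exact 𝔼.sub_id _

/-- The identity contextual functor. -/
def id (𝔻 : ContextualCategory.{v₁, u₁, w₁}) : ContextualFunctor 𝔻 𝔻 where
  toFunctor := 𝟭 _
  mapTy A := A
  obj_empty := rfl
  mapTy_sub _ _ := rfl
  obj_ext _ := rfl
  map_proj A := by simp
  map_q f A := by simp

/-- Composition of contextual functors. -/
def comp (G : ContextualFunctor 𝔻 𝔼) (H : ContextualFunctor 𝔼 𝔽) : ContextualFunctor 𝔻 𝔽 where
  toFunctor := G.toFunctor ⋙ H.toFunctor
  mapTy A := H.mapTy (G.mapTy A)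
  obj_empty := by simp [G.obj_empty, H.obj_empty]
  mapTy_sub f A := by simp [G.mapTy_sub, H.mapTy_sub]
  obj_ext A := by simp [G.obj_ext, H.obj_ext]
  map_proj A := by simp [G.map_proj, H.map_proj, eqToHom_map]
  map_q f A := by simp [G.map_q, H.map_q, eqToHom_map]

end ContextualFunctor

/-- The category `ConCat` of contextual categories and contextual functors. -/
instance : Category.{max v u w} ContextualCategory.{v, u, w} where
  Hom := ContextualFunctor
  id := ContextualFunctor.id
  comp := ContextualFunctor.comp

/-- A contextually indexed contextual category: a contextual category `base` together with a
functor `baseᵒᵖ ⥤ ConCat`. -/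
structure IndexedContextualCategory :
    Type (max (u + 1) (v + 1) (w + 1) (u₁ + 1) (v₁ + 1) (w₁ + 1)) where
  base : ContextualCategory.{v, u, w}
  indexed : base.Ctxᵒᵖ ⥤ ContextualCategory.{v₁, u₁, w₁}

theorem eqToHom_cancel {C : Type u} [Category.{v} C] {X Y Z : C} (f : X ⟶ Y) (h : Y = Z)
    (h' : Z = Y) : f ≫ eqToHom h ≫ eqToHom h' = f := by
  simp

theorem eqToHom_cancel_assoc {C : Type u} [Category.{v} C] {X Y Z W V U : C} (f : X ⟶ Y)
    (g : Y ⟶ W) (h : Y = Z) (h' : Z = Y) (k : W = V) (k' : V = U) (l : W = U) :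
    (f ≫ eqToHom h) ≫ eqToHom h' ≫ g ≫ eqToHom k ≫ eqToHom k' = f ≫ g ≫ eqToHom l := by
  simp

namespace IndexedContextualCategory

variable (𝒟 : IndexedContextualCategory.{v, u, w, v₁, u₁, w₁})

/-- Reindexing along a morphism of base contexts. -/
abbrev reindex {Γ' Γ : 𝒟.base.Ctx} (σ : Γ' ⟶ Γ) :
    ContextualFunctor (𝒟.indexed.obj (.op Γ)) (𝒟.indexed.obj (.op Γ')) :=
  𝒟.indexed.map σ.op

theorem reindex_id (Γ : 𝒟.base.Ctx) :
    𝒟.reindex (𝟙 Γ) = ContextualFunctor.id (𝒟.indexed.obj (.op Γ)) :=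
  𝒟.indexed.map_id _

theorem reindex_comp {Γ'' Γ' Γ : 𝒟.base.Ctx} (τ : Γ'' ⟶ Γ') (σ : Γ' ⟶ Γ) :
    𝒟.reindex (τ ≫ σ) = (𝒟.reindex σ).comp (𝒟.reindex τ) :=
  𝒟.indexed.map_comp σ.op τ.op

theorem reindex_id_obj {Γ : 𝒟.base.Ctx} (Δ : (𝒟.indexed.obj (.op Γ)).Ctx) :
    (𝒟.reindex (𝟙 Γ)).toFunctor.obj Δ = Δ := by
  rw [reindex_id]; rfl

theorem reindex_comp_obj {Γ'' Γ' Γ : 𝒟.base.Ctx} (τ : Γ'' ⟶ Γ') (σ : Γ' ⟶ Γ)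
    (Δ : (𝒟.indexed.obj (.op Γ)).Ctx) :
    (𝒟.reindex (τ ≫ σ)).toFunctor.obj Δ =
      (𝒟.reindex τ).toFunctor.obj ((𝒟.reindex σ).toFunctor.obj Δ) := by
  rw [reindex_comp]; rfl

theorem reindex_comp_map {Γ'' Γ' Γ : 𝒟.base.Ctx} (τ : Γ'' ⟶ Γ') (σ : Γ' ⟶ Γ)
    {Δ' Δ : (𝒟.indexed.obj (.op Γ)).Ctx} (δ : Δ' ⟶ Δ) :
    (𝒟.reindex (τ ≫ σ)).toFunctor.map δ =
      eqToHom (𝒟.reindex_comp_obj τ σ Δ') ≫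
        (𝒟.reindex τ).toFunctor.map ((𝒟.reindex σ).toFunctor.map δ) ≫
          eqToHom (𝒟.reindex_comp_obj τ σ Δ).symm :=
  Functor.congr_hom (congrArg ContextualFunctor.toFunctor (𝒟.reindex_comp τ σ)) δ

theorem reindex_id_map {Γ : 𝒟.base.Ctx} {Δ' Δ : (𝒟.indexed.obj (.op Γ)).Ctx} (δ : Δ' ⟶ Δ) :
    (𝒟.reindex (𝟙 Γ)).toFunctor.map δ =
      eqToHom (𝒟.reindex_id_obj Δ') ≫ δ ≫ eqToHom (𝒟.reindex_id_obj Δ).symm :=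
  Functor.congr_hom (congrArg ContextualFunctor.toFunctor (𝒟.reindex_id Γ)) δ

/-! ### Contexts `Γ | Δ` and simultaneous reindexing and substitution -/

/-- A context `Γ | Δ` : a base context `Γ` and an indexed context `Δ` over it. -/
structure MCtx where
  base : 𝒟.base.Ctx
  idx : (𝒟.indexed.obj (.op base)).Ctx

variable {𝒟}

/-- A morphism `Γ' | Δ' ⟶ Γ | Δ` : a base morphism `σ : Γ' ⟶ Γ` and a morphism from `Δ'` to
the reindexing of `Δ` along `σ`. -/
structure MCtx.Hom (X Y : 𝒟.MCtx) where
  base : X.base ⟶ Y.base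
  idx : X.idx ⟶ (𝒟.reindex base).toFunctor.obj Y.idx

theorem MCtx.Hom.hext {X Y : 𝒟.MCtx} {f g : MCtx.Hom X Y} (h : f.base = g.base)
    (h' : f.idx ≫ eqToHom (by rw [h]) = g.idx) : f = g := by
  obtain ⟨fb, fi⟩ := f
  obtain ⟨gb, gi⟩ := g
  dsimp at h
  subst h
  simp at h'
  subst h'
  rfl

/-- Auxiliary form of `reindex_comp_map` for equal base morphisms. -/
theorem eqToHom_reindex {Γ' Γ : 𝒟.base.Ctx} {σ τ : Γ' ⟶ Γ} (h : σ = τ)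
    {Δ' Δ : (𝒟.indexed.obj (.op Γ)).Ctx} (δ : Δ' ⟶ Δ) :
    (𝒟.reindex σ).toFunctor.map δ =
      eqToHom (by rw [h]) ≫ (𝒟.reindex τ).toFunctor.map δ ≫ eqToHom (by rw [h]) := by
  subst h
  simp

instance : Category 𝒟.MCtx where
  Hom := MCtx.Hom
  id X := ⟨𝟙 _, eqToHom (𝒟.reindex_id_obj X.idx).symm⟩
  comp f g := ⟨f.base ≫ g.base, f.idx ≫ (𝒟.reindex f.base).toFunctor.map g.idx ≫
    eqToHom (𝒟.reindex_comp_obj f.base g.base _).symm⟩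
  id_comp f := MCtx.Hom.hext (Category.id_comp _) (by simp [reindex_id_map])
  comp_id f := MCtx.Hom.hext (Category.comp_id _) (by simp [eqToHom_map])
  assoc f g h := MCtx.Hom.hext (Category.assoc _ _ _)
    (by simp [reindex_comp_map, eqToHom_map])

@[simp] theorem id_base (X : 𝒟.MCtx) : MCtx.Hom.base (𝟙 X) = 𝟙 X.base := rfl

theorem id_idx (X : 𝒟.MCtx) :
    MCtx.Hom.idx (𝟙 X) = eqToHom (𝒟.reindex_id_obj X.idx).symm := rfl

@[simp] theorem comp_base {X Y Z : 𝒟.MCtx} (f : X ⟶ Y) (g : Y ⟶ Z) :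
    (f ≫ g).base = f.base ≫ g.base := rfl

theorem comp_idx {X Y Z : 𝒟.MCtx} (f : X ⟶ Y) (g : Y ⟶ Z) :
    (f ≫ g).idx = f.idx ≫ (𝒟.reindex f.base).toFunctor.map g.idx ≫
      eqToHom (𝒟.reindex_comp_obj f.base g.base _).symm := rfl

theorem hom_hext {X Y : 𝒟.MCtx} {f g : X ⟶ Y} (h : f.base = g.base)
    (h' : f.idx ≫ eqToHom (by rw [h]) = g.idx) : f = g :=
  MCtx.Hom.hext h h'

theorem idx_congr {X Y : 𝒟.MCtx} {f g : X ⟶ Y} (h : f = g) :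
    f.idx ≫ eqToHom (by rw [h]) = g.idx := by
  subst h
  simp

namespace MCtx

/-- Types `Γ | Δ ⊢ A`. -/
abbrev Ty (X : 𝒟.MCtx) : Type w₁ := (𝒟.indexed.obj (.op X.base)).Ty X.idx

/-- Base types `Γ ⊢ I`. -/
abbrev BTy (X : 𝒟.MCtx) : Type w := 𝒟.base.Ty X.base

/-- The context `Γ | Δ, x : A`. -/
abbrev ext (X : 𝒟.MCtx) (A : X.Ty) : 𝒟.MCtx :=
  ⟨X.base, (𝒟.indexed.obj (.op X.base)).ext X.idx A⟩

/-- The projection from `Γ | Δ, x : A` to `Γ | Δ`. -/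
def proj {X : 𝒟.MCtx} (A : X.Ty) : X.ext A ⟶ X :=
  ⟨𝟙 X.base, (𝒟.indexed.obj (.op X.base)).proj A ≫ eqToHom (𝒟.reindex_id_obj X.idx).symm⟩

/-- The type `A[f]` obtained by reindexing `A` along the base component of `f` and then
substituting the indexed component. -/
def sub {X Y : 𝒟.MCtx} (f : X ⟶ Y) (A : Y.Ty) : X.Ty :=
  (𝒟.indexed.obj (.op X.base)).sub f.idx ((𝒟.reindex f.base).mapTy A)

theorem sub_id {X : 𝒟.MCtx} (A : X.Ty) : sub (𝟙 X) A = A := by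
  have h := ContextualFunctor.mapTy_congr (𝒟.reindex_id X.base).symm A
  exact h

theorem sub_comp {X Y Z : 𝒟.MCtx} (f : X ⟶ Y) (g : Y ⟶ Z) (A : Z.Ty) :
    sub (f ≫ g) A = sub f (sub g A) := by
  have h := ContextualFunctor.mapTy_congr (𝒟.reindex_comp f.base g.base).symm A
  unfold sub
  rw [comp_idx, ContextualFunctor.mapTy_sub, ContextualCategory.sub_comp,
    ContextualCategory.sub_comp]
  exact congrArg _ (congrArg _ h)

/-- The canonical map from `X.A[f]` to `Y.A` over `f : X ⟶ Y`. -/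
def q {X Y : 𝒟.MCtx} (f : X ⟶ Y) (A : Y.Ty) : X.ext (sub f A) ⟶ Y.ext A :=
  ⟨f.base, (𝒟.indexed.obj (.op X.base)).q f.idx ((𝒟.reindex f.base).mapTy A) ≫
    eqToHom ((𝒟.reindex f.base).obj_ext A).symm⟩

theorem q_proj {X Y : 𝒟.MCtx} (f : X ⟶ Y) (A : Y.Ty) :
    q f A ≫ proj A = proj (sub f A) ≫ f := by
  refine hom_hext ((Category.comp_id _).trans (Category.id_comp _).symm) ?_
  have h := ContextualCategory.q_proj f.idx ((𝒟.reindex f.base).mapTy A)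
  simp [comp_idx, q, proj, ContextualFunctor.map_proj, reindex_id_map, eqToHom_map]
  exact (eqToHom_cancel_assoc _ _ _ _ _ _ _).trans ((reassoc_of% h) _)

/-- A term `Γ | Δ ⊢ a : A` : a section of the projection. -/
@[ext]
structure Tm {X : 𝒟.MCtx} (A : X.Ty) where
  hom : X ⟶ X.ext A
  hom_proj : hom ≫ proj A = 𝟙 X

/-! ### Weakening and substitution of base variables -/

/-- The context `Γ, i : I | Δ`. -/
abbrev weaken (X : 𝒟.MCtx) (I : X.BTy) : 𝒟.MCtx :=
  ⟨𝒟.base.ext X.base I, (𝒟.reindex (𝒟.base.proj I)).toFunctor.obj X.idx⟩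

/-- The projection from `Γ, i : I | Δ` to `Γ | Δ`. -/
def wproj (X : 𝒟.MCtx) (I : X.BTy) : X.weaken I ⟶ X :=
  ⟨𝒟.base.proj I, 𝟙 _⟩

/-- The morphism to `Γ, i : I | Δ` induced by a morphism `f` to `Γ | Δ` together with a lift of
its base component to `Γ, i : I`. -/
def wlift {X Y : 𝒟.MCtx} {I : X.BTy} (f : Y ⟶ X) (τ : Y.base ⟶ 𝒟.base.ext X.base I)
    (h : τ ≫ 𝒟.base.proj I = f.base) : Y ⟶ X.weaken I :=
  ⟨τ, f.idx ≫ eqToHom (by rw [← h, reindex_comp_obj])⟩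

theorem wlift_wproj {X Y : 𝒟.MCtx} {I : X.BTy} (f : Y ⟶ X)
    (τ : Y.base ⟶ 𝒟.base.ext X.base I) (h : τ ≫ 𝒟.base.proj I = f.base) :
    wlift f τ h ≫ wproj X I = f :=
  by
  refine hom_hext h ?_
  simp [comp_idx, wlift, wproj]
  exact eqToHom_cancel _ _ _

theorem weaken_hom_ext {X Y : 𝒟.MCtx} {I : X.BTy} {f g : Y ⟶ X.weaken I}
    (h : f.base = g.base) (h' : f ≫ wproj X I = g ≫ wproj X I) : f = g := by
  obtain ⟨fb, fi⟩ := f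
  obtain ⟨gb, gi⟩ := g
  dsimp at h
  subst h
  have h₁ := idx_congr h'
  simp [comp_idx, wproj] at h₁
  have h₂ : fi = gi := (cancel_mono (eqToHom _)).1 h₁
  rw [h₂]

/-- The substitution `j / i` from `Γ | Δ` to `Γ, i : I | Δ`, where `Γ ⊢ j : I`. -/
def inst (X : 𝒟.MCtx) {I : X.BTy} (j : ContextualCategory.Tm I) : X ⟶ X.weaken I :=
  wlift (𝟙 X) j.hom j.hom_proj

theorem inst_wproj (X : 𝒟.MCtx) {I : X.BTy} (j : ContextualCategory.Tm I) :
    X.inst j ≫ wproj X I = 𝟙 X :=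
  wlift_wproj _ _ _

/-- The type `I[f]` for a base type `I`; only the base component of `f` acts on it. -/
abbrev bsub {X Y : 𝒟.MCtx} (f : X ⟶ Y) (I : Y.BTy) : X.BTy := 𝒟.base.sub f.base I

/-- The extension of `f : X ⟶ Y` to the contexts weakened by `I[f]` and `I`. -/
def wmap {X Y : 𝒟.MCtx} (f : X ⟶ Y) (I : Y.BTy) : X.weaken (bsub f I) ⟶ Y.weaken I :=
  wlift (wproj X (bsub f I) ≫ f) (𝒟.base.q f.base I) (ContextualCategory.q_proj _ _)

theorem wmap_wproj {X Y : 𝒟.MCtx} (f : X ⟶ Y) (I : Y.BTy) :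
    wmap f I ≫ wproj Y I = wproj X (bsub f I) ≫ f :=
  wlift_wproj _ _ _

theorem inst_wmap {X Y : 𝒟.MCtx} (f : X ⟶ Y) {I : Y.BTy} (j : ContextualCategory.Tm I) :
    X.inst (j.sub f.base) ≫ wmap f I = f ≫ Y.inst j := by
  apply weaken_hom_ext
  · exact ContextualCategory.Tm.sub_q _ _
  · rw [Category.assoc, wmap_wproj, ← Category.assoc, inst_wproj, Category.assoc, inst_wproj]
    simp

/-- The last base variable `i` of `Γ, i : I`. -/
abbrev bvar (X : 𝒟.MCtx) (I : X.BTy) :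
    ContextualCategory.Tm (bsub (wproj X I) I) :=
  ContextualCategory.var I

theorem inst_bvar (X : 𝒟.MCtx) (I : X.BTy) :
    (X.weaken I).inst (X.bvar I) ≫ wmap (wproj X I) I = 𝟙 _ := by
  apply weaken_hom_ext
  · exact ContextualCategory.var_q I
  · rw [Category.assoc, wmap_wproj, ← Category.assoc, inst_wproj]

theorem sub_inst_wmap {X Y : 𝒟.MCtx} (f : X ⟶ Y) {I : Y.BTy} (B : (Y.weaken I).Ty)
    (j : ContextualCategory.Tm I) :
    sub f (sub (Y.inst j) B) = sub (X.inst (j.sub f.base)) (sub (wmap f I) B) := by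
  rw [← sub_comp, ← sub_comp, inst_wmap]

theorem sub_inst_bvar {X : 𝒟.MCtx} {I : X.BTy} (B : (X.weaken I).Ty) :
    B = sub ((X.weaken I).inst (X.bvar I)) (sub (wmap (wproj X I) I) B) := by
  rw [← sub_comp, inst_bvar, sub_id]

end MCtx

end IndexedContextualCategory

/-! ### Stable dependent coproducts -/

open IndexedContextualCategory MCtx

/-- The formation and introduction rules for dependent coproducts
`Γ | Δ ⊢ ∐ (i : I), B i` and `Γ | Δ, x : B j ⊢ in_j(x) : ∐ (i : I), B i`,
stable under reindexing and substitution. -/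
structure CoproductFormation (𝒟 : IndexedContextualCategory.{v, u, w, v₁, u₁, w₁}) where
  coprod : ∀ (X : 𝒟.MCtx) (I : X.BTy), (X.weaken I).Ty → X.Ty
  coprod_sub : ∀ {X Y : 𝒟.MCtx} (f : X ⟶ Y) (I : Y.BTy) (B : (Y.weaken I).Ty),
    sub f (coprod Y I B) = coprod X (bsub f I) (sub (wmap f I) B)
  inj : ∀ {X : 𝒟.MCtx} {I : X.BTy} (B : (X.weaken I).Ty) (j : ContextualCategory.Tm I),
    Tm (sub (proj (sub (X.inst j) B)) (coprod X I B))
  /-- `in_{j[f]}(x) = in_j(x)[f]`, an equation between terms of `(∐ (i : I), B i)[f]` in context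
  `B_j[f]`; both sides are written as maps to the extension of `Y` by the coproduct. -/
  inj_sub : ∀ {X Y : 𝒟.MCtx} (f : X ⟶ Y) {I : Y.BTy} (B : (Y.weaken I).Ty)
    (j : ContextualCategory.Tm I),
    eqToHom (congrArg X.ext (sub_inst_wmap f B j)) ≫
      ((inj (sub (wmap f I) B) (j.sub f.base)).hom ≫ q (proj _) _) ≫
        eqToHom (congrArg X.ext (coprod_sub f I B).symm) ≫ q f (coprod Y I B) =
    q f (sub (Y.inst j) B) ≫ (inj B j).hom ≫ q (proj _) _

namespace CoproductFormation

variable {𝒟 : IndexedContextualCategory.{v, u, w, v₁, u₁, w₁}} (K : CoproductFormation 𝒟)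

/-- The substitution `in_j(x) / z` from `Γ | Δ, x : B j` to `Γ | Δ, z : ∐ (i : I), B i`. -/
def injHom {X : 𝒟.MCtx} {I : X.BTy} (B : (X.weaken I).Ty) (j : ContextualCategory.Tm I) :
    X.ext (sub (X.inst j) B) ⟶ X.ext (K.coprod X I B) :=
  (K.inj B j).hom ≫ q (proj _) _

/-- The substitution `in_i(x) / z` from `Γ, i : I | Δ, x : B i` to
`Γ | Δ, z : ∐ (i : I), B i`, where `i` is the variable. -/
def genInj {X : 𝒟.MCtx} {I : X.BTy} (B : (X.weaken I).Ty) :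
    (X.weaken I).ext B ⟶ X.ext (K.coprod X I B) :=
  eqToHom (congrArg (X.weaken I).ext (sub_inst_bvar B)) ≫
    K.injHom (sub (wmap (wproj X I) I) B) (X.bvar I) ≫
      eqToHom (congrArg (X.weaken I).ext (K.coprod_sub (wproj X I) I B).symm) ≫
        q (wproj X I) (K.coprod X I B)

/-- The extension of `f : X ⟶ Y` to the contexts extended by the coproducts over `I[f]`
and `I`. -/
def coprodMap {X Y : 𝒟.MCtx} (f : X ⟶ Y) {I : Y.BTy} (B : (Y.weaken I).Ty) :
    X.ext (K.coprod X (bsub f I) (sub (wmap f I) B)) ⟶ Y.ext (K.coprod Y I B) :=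
  eqToHom (congrArg X.ext (K.coprod_sub f I B).symm) ≫ q f (K.coprod Y I B)

end CoproductFormation

/-- Stable dependent coproducts: formation, introduction, elimination and computation rules,
all stable under reindexing and substitution. -/
structure StableDependentCoproducts (𝒟 : IndexedContextualCategory.{v, u, w, v₁, u₁, w₁})
    extends CoproductFormation 𝒟 where
  /-- From `Γ | Δ, z : ∐ (i : I), B i ⊢ D` and `Γ, i : I | Δ, x : B i ⊢ d : D[in_i(x) / z]`
  infer a term of type `D` in context `Γ | Δ, z : ∐ (i : I), B i`. -/
  elim : ∀ {X : 𝒟.MCtx} {I : X.BTy} {B : (X.weaken I).Ty}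
    (D : (X.ext (toCoproductFormation.coprod X I B)).Ty),
    Tm (sub (toCoproductFormation.genInj B) D) → Tm D
  /-- The computation rule `elim(z.D, i x.d)[in_j(x) / z] = d[j / i]`; both sides are terms of type
  `D[in_j(x) / z]` in context `Γ | Δ, x : B j`, written as maps to the extension by `D`. -/
  elim_inj : ∀ {X : 𝒟.MCtx} {I : X.BTy} {B : (X.weaken I).Ty}
    (D : (X.ext (toCoproductFormation.coprod X I B)).Ty)
    (d : Tm (sub (toCoproductFormation.genInj B) D)) (j : ContextualCategory.Tm I),
    toCoproductFormation.injHom B j ≫ (elim D d).hom =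
      q (X.inst j) B ≫ d.hom ≫ q (toCoproductFormation.genInj B) D
  /-- `elim(z.D, i x.d)[f] = elim(z.D[f], i x.d[f])`. The hypothesis on `d'` says that it is the
  substitution `d[f]`, and the conclusion that the eliminator of `d'` is the substitution of the
  eliminator of `d`. -/
  elim_sub : ∀ {X Y : 𝒟.MCtx} (f : X ⟶ Y) {I : Y.BTy} {B : (Y.weaken I).Ty}
    (D : (Y.ext (toCoproductFormation.coprod Y I B)).Ty)
    (d : Tm (sub (toCoproductFormation.genInj B) D))
    (d' : Tm (sub (toCoproductFormation.genInj (sub (wmap f I) B))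
      (sub (toCoproductFormation.coprodMap f B) D))),
    d'.hom ≫ q (toCoproductFormation.genInj (sub (wmap f I) B)) _ ≫
        q (toCoproductFormation.coprodMap f B) D =
      q (wmap f I) B ≫ d.hom ≫ q (toCoproductFormation.genInj B) D →
    (elim (sub (toCoproductFormation.coprodMap f B) D) d').hom ≫
        q (toCoproductFormation.coprodMap f B) D =
      toCoproductFormation.coprodMap f B ≫ (elim D d).hom

/-- The contextually indexed contextual category `𝒟` has stable dependent coproducts. -/
def HasStableDependentCoproducts
    (𝒟 : IndexedContextualCategory.{v, u, w, v₁, u₁, w₁}) : Prop :=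
  Nonempty (StableDependentCoproducts 𝒟)

/-! ### Categories with fibrations -/

/-- A category with fibrations: a category with a terminal object and a class of maps, called
fibrations, such that pullbacks of fibrations (along arbitrary maps) exist and are fibrations. -/
class CatWithFib (C : Type u) [Category.{v} C] where
  /-- fibrations -/
  fib : MorphismProperty C
  hasTerminal : HasTerminal C
  hasPullback : ∀ {X Y Z : C} (f : X ⟶ Z) (p : Y ⟶ Z), fib p → HasPullback f p
  isStableUnderBaseChange : fib.IsStableUnderBaseChange

attribute [instance] CatWithFib.hasTerminal CatWithFib.isStableUnderBaseChange

section Notions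

variable {C : Type u} [Category.{v} C]

/-- A map `f : X ⟶ Y` is exponentiable if pullbacks along `f` exist and the pullback functor
`C/Y ⥤ C/X` has a right adjoint. -/
def Exponentiable {X Y : C} (f : X ⟶ Y) : Prop :=
  ∃ _ : HasPullbacksAlong f, (Over.pullback f).IsLeftAdjoint

variable [CatWithFib C]

/-- A trivial cofibration is a map with the left lifting property with respect to fibrations. -/
def IsTrivCof {X Y : C} (i : X ⟶ Y) : Prop :=
  ∀ ⦃E V : C⦄ (p : E ⟶ V), CatWithFib.fib p → HasLiftingProperty i p

/-- A quasifibration is a map that factors as a trivial cofibration `i` followed by a fibration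
`p` such that, for every map into the base, the induced pullback `i'` of `i` is a trivial
cofibration. -/
def IsQuasifibration {X Z : C} (f : X ⟶ Z) : Prop :=
  ∃ (Y : C) (i : X ⟶ Y) (p : Y ⟶ Z), IsTrivCof i ∧ CatWithFib.fib p ∧ i ≫ p = f ∧
    ∀ ⦃X' Y' Z' : C⦄ (x : X' ⟶ X) (y : Y' ⟶ Y) (z : Z' ⟶ Z) (i' : X' ⟶ Y') (p' : Y' ⟶ Z'),
      IsPullback x i' i y → IsPullback y p' p z → IsTrivCof i'

end Notions

section FNotions

variable {B : Type u₁} [Category.{v₁} B] [CatWithFib B] {C : Type u₂} [Category.{v₂} C]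

/-- An `F`-fibration is a pullback of `F(p)` for some fibration `p`. -/
def IsFFibration (F : B ⥤ C) {X Y : C} (g : X ⟶ Y) : Prop :=
  ∃ (E V : B) (p : E ⟶ V) (t : X ⟶ F.obj E) (b : Y ⟶ F.obj V),
    CatWithFib.fib p ∧ IsPullback t g (F.map p) b

/-- `F` sends pullback squares of fibrations along arbitrary maps to pullback squares. -/
def PreservesPullbacksAlongFib (F : B ⥤ C) : Prop :=
  ∀ ⦃X Y E V : B⦄ (t : X ⟶ E) (s : X ⟶ Y) (p : E ⟶ V) (b : Y ⟶ V),
    CatWithFib.fib p → IsPullback t s p b →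
      IsPullback (F.map t) (F.map s) (F.map p) (F.map b)

end FNotions

/-! ### The local universes model -/

section LocalUniverses

variable {C : Type u} [Category.{v} C] [CatWithFib C]

/-- A type over `X` in the local universes model: a diagram `X ⟶ V ⟵ E` whose second map is
a fibration. -/
structure LUTy (X : C) where
  V : C
  E : C
  p : E ⟶ V
  fib : CatWithFib.fib p
  r : X ⟶ V

namespace LUTy

/-- Substitution is composition with the first map of the diagram. -/
abbrev sub {X' X : C} (f : X' ⟶ X) (A : LUTy X) : LUTy X' :=
  { A with r := f ≫ A.r }

theorem sub_id {X : C} (A : LUTy X) : A.sub (𝟙 X) = A := by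
  simp [sub]

theorem sub_comp {X'' X' X : C} (g : X'' ⟶ X') (f : X' ⟶ X) (A : LUTy X) :
    A.sub (g ≫ f) = (A.sub f).sub g := by
  simp [sub]

instance {X : C} (A : LUTy X) : HasPullback A.r A.p :=
  CatWithFib.hasPullback _ _ A.fib

/-- The extension of `X` by a type is the (chosen) pullback of the diagram. -/
def ext {X : C} (A : LUTy X) : C := pullback A.r A.p

/-- The projection to `X`. -/
def proj {X : C} (A : LUTy X) : A.ext ⟶ X := pullback.fst A.r A.p

/-- The projection to `E`. -/
def gen {X : C} (A : LUTy X) : A.ext ⟶ A.E := pullback.snd A.r A.p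

theorem isPullback_ext {X : C} (A : LUTy X) : IsPullback A.gen A.proj A.p A.r :=
  (IsPullback.of_hasPullback A.r A.p).flip

/-- The map of extensions induced by `f : X' ⟶ X`. -/
def q {X' X : C} (f : X' ⟶ X) (A : LUTy X) : (A.sub f).ext ⟶ A.ext :=
  A.isPullback_ext.lift (A.sub f).gen ((A.sub f).proj ≫ f)
    (by simpa using (A.sub f).isPullback_ext.w)

theorem q_gen {X' X : C} (f : X' ⟶ X) (A : LUTy X) : A.q f ≫ A.gen = (A.sub f).gen := by
  simp [q]

theorem q_proj {X' X : C} (f : X' ⟶ X) (A : LUTy X) :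
    A.q f ≫ A.proj = (A.sub f).proj ≫ f := by
  simp [q]

theorem isPullback_q {X' X : C} (f : X' ⟶ X) (A : LUTy X) :
    IsPullback (A.q f) (A.sub f).proj A.proj f := by
  refine IsPullback.of_right ?_ (A.q_proj f) A.isPullback_ext
  rw [q_gen]
  exact (A.sub f).isPullback_ext

theorem q_congr {X' X : C} {f g : X' ⟶ X} (h : f = g) (A : LUTy X) :
    A.q f = eqToHom (by rw [h]) ≫ A.q g := by
  subst h
  simp

theorem eqToHom_proj {X : C} {A A' : LUTy X} (h : A = A') :
    eqToHom (congrArg ext h) ≫ A'.proj = A.proj := by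
  subst h
  simp

theorem eqToHom_gen {X : C} {A A' : LUTy X} (h : A = A') :
    eqToHom (congrArg ext h) ≫ A'.gen = A.gen ≫ eqToHom (congrArg E h) := by
  subst h
  simp

theorem q_id {X : C} (A : LUTy X) : A.q (𝟙 X) = eqToHom (by rw [sub_id]) := by
  apply A.isPullback_ext.hom_ext
  · rw [q_gen, eqToHom_gen A.sub_id]; simp
  · rw [q_proj, eqToHom_proj A.sub_id]; simp

theorem q_comp {X'' X' X : C} (g : X'' ⟶ X') (f : X' ⟶ X) (A : LUTy X) :
    A.q (g ≫ f) = eqToHom (by rw [sub_comp]) ≫ (A.sub f).q g ≫ A.q f := by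
  apply A.isPullback_ext.hom_ext
  · rw [Category.assoc, Category.assoc, q_gen, q_gen, q_gen, eqToHom_gen (A.sub_comp g f)]; simp
  · rw [Category.assoc, Category.assoc, q_proj, q_proj, reassoc_of% (A.sub f).q_proj g,
      reassoc_of% eqToHom_proj (A.sub_comp g f)]

end LUTy

/-- Finite lists of types over `X`, each over the iterated extension of `X` by the previous ones;
the index `Y` is the iterated extension. -/
inductive Tel (X : C) : C → Type (max u v)
  | nil : Tel X X
  | snoc {Y : C} (T : Tel X Y) (A : LUTy Y) : Tel X A.ext

namespace Tel

/-- The display map of an iterated extension. -/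
def disp {X : C} : {Y : C} → Tel X Y → (Y ⟶ X)
  | _, nil => 𝟙 X
  | _, snoc T A => A.proj ≫ T.disp

/-- The length of a list of types. -/
def length {X : C} : {Y : C} → Tel X Y → ℕ
  | _, nil => 0
  | _, snoc T _ => T.length + 1

/-- The last type of a nonempty list, together with the preceding list. -/
def last {X : C} : {Y : C} → Tel X Y → Option (Σ (Z : C) (_ : Tel X Z), LUTy Z)
  | _, nil => none
  | _, snoc T A => some ⟨_, T, A⟩

end Tel

/-- A context over `X` in the local universes model. -/
structure TelCtx (X : C) where
  obj : C
  tel : Tel X obj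

/-- A morphism of contexts over `X`: a map of iterated extensions over `X`. -/
@[ext]
structure TelCtx.Hom {X : C} (S T : TelCtx X) where
  hom : S.obj ⟶ T.obj
  w : hom ≫ T.tel.disp = S.tel.disp

namespace TelCtx

variable {X : C}

instance : Category (TelCtx X) where
  Hom := TelCtx.Hom
  id T := ⟨𝟙 _, Category.id_comp _⟩
  comp f g := ⟨f.hom ≫ g.hom, by rw [Category.assoc, g.w, f.w]⟩
  id_comp f := TelCtx.Hom.ext (Category.id_comp _)
  comp_id f := TelCtx.Hom.ext (Category.comp_id _)
  assoc f g h := TelCtx.Hom.ext (Category.assoc _ _ _)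

@[ext] theorem hom_ext {S T : TelCtx X} {f g : S ⟶ T} (h : f.hom = g.hom) : f = g :=
  TelCtx.Hom.ext h

@[simp] theorem id_hom (T : TelCtx X) : TelCtx.Hom.hom (𝟙 T) = 𝟙 T.obj := rfl

@[simp] theorem comp_hom {R S T : TelCtx X} (f : R ⟶ S) (g : S ⟶ T) :
    (f ≫ g).hom = f.hom ≫ g.hom := rfl

@[simp] theorem eqToHom_hom {S T : TelCtx X} (h : S = T) :
    (eqToHom h).hom = eqToHom (congrArg obj h) := by
  subst h
  rfl

variable (X) in
/-- The underlying object of a context. -/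
@[simps] def interp : TelCtx X ⥤ C where
  obj T := T.obj
  map f := f.hom

/-- The empty context over `X`. -/
abbrev nil (X : C) : TelCtx X := ⟨X, .nil⟩

/-- Extension of a context by a type. -/
abbrev snoc (T : TelCtx X) (A : LUTy T.obj) : TelCtx X := ⟨A.ext, T.tel.snoc A⟩

/-- The projection from an extended context. -/
abbrev proj (T : TelCtx X) (A : LUTy T.obj) : T.snoc A ⟶ T := ⟨A.proj, rfl⟩

/-- The map of extended contexts over a morphism of contexts. -/
abbrev q {S T : TelCtx X} (f : S ⟶ T) (A : LUTy T.obj) : S.snoc (A.sub f.hom) ⟶ T.snoc A :=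
  ⟨A.q f.hom, by
    change A.q f.hom ≫ A.proj ≫ T.tel.disp = (A.sub f.hom).proj ≫ S.tel.disp
    rw [← f.w, ← Category.assoc, LUTy.q_proj, Category.assoc]⟩

theorem q_id {T : TelCtx X} (A : LUTy T.obj)
    (h : T.snoc (A.sub (TelCtx.Hom.hom (𝟙 T))) = T.snoc A) : q (𝟙 T) A = eqToHom h := by
  apply hom_ext
  rw [eqToHom_hom h]
  exact A.q_id

theorem q_comp {R S T : TelCtx X} (g : R ⟶ S) (f : S ⟶ T) (A : LUTy T.obj)
    (h : R.snoc (A.sub (g ≫ f).hom) = R.snoc ((A.sub f.hom).sub g.hom)) :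
    q (g ≫ f) A = eqToHom h ≫ q g (A.sub f.hom) ≫ q f A := by
  apply hom_ext
  rw [comp_hom (eqToHom h), comp_hom (q g _), eqToHom_hom h]
  exact A.q_comp g.hom f.hom

theorem isPullback_q {S T : TelCtx X} (f : S ⟶ T) (A : LUTy T.obj) :
    IsPullback (q f A) (S.proj (A.sub f.hom)) (T.proj A) f := by
  refine ⟨⟨hom_ext (A.q_proj f.hom)⟩, ⟨PullbackCone.IsLimit.mk _ ?_ ?_ ?_ ?_⟩⟩
  · intro s
    refine ⟨(A.isPullback_q f.hom).lift s.fst.hom s.snd.hom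
      (congrArg TelCtx.Hom.hom s.condition), ?_⟩
    change _ ≫ (A.sub f.hom).proj ≫ S.tel.disp = _
    rw [IsPullback.lift_snd_assoc, s.snd.w]
  · intro s
    exact hom_ext (IsPullback.lift_fst _ _ _ _)
  · intro s
    exact hom_ext (IsPullback.lift_snd _ _ _ _)
  · intro s m h₁ h₂
    apply hom_ext
    apply (A.isPullback_q f.hom).hom_ext
    · rw [IsPullback.lift_fst, ← h₁]; rfl
    · rw [IsPullback.lift_snd, ← h₂]; rfl

end TelCtx

/-- The contextual category of the local universes model over an object `X`. Its contexts are
finite lists of types, the first one being a diagram `X ⟶ V ⟵ E`. -/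
def localUniverses (X : C) : ContextualCategory.{v, max u v, max u v} where
  Ctx := TelCtx X
  Ty T := LUTy T.obj
  sub f A := LUTy.sub (TelCtx.Hom.hom f) A
  sub_id A := A.sub_id
  sub_comp g f A := LUTy.sub_comp (TelCtx.Hom.hom g) (TelCtx.Hom.hom f) A
  ext T A := T.snoc A
  proj A := TelCtx.proj _ A
  q f A := TelCtx.q f A
  isPullback f A := TelCtx.isPullback_q f A
  q_id A := TelCtx.q_id A _
  q_comp g f A := TelCtx.q_comp g f A _
  empty := TelCtx.nil X
  isTerminal := IsTerminal.ofUniqueHom (fun T => ⟨T.tel.disp, Category.comp_id _⟩)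
    (fun T m => TelCtx.hom_ext ((Category.comp_id _).symm.trans m.w))
  length T := T.tel.length
  length_ext _ _ := rfl
  length_eq_zero := by
    rintro ⟨Y, T⟩
    cases T with
    | nil => exact ⟨fun _ => rfl, fun _ => rfl⟩
    | snoc T A =>
      exact ⟨fun h => absurd h (Nat.succ_ne_zero _),
        fun h => congrArg (fun T : TelCtx X => T.tel.length) h⟩
  existsUnique_ext := by
    rintro ⟨Y, T⟩ h
    cases T with
    | nil => exact absurd rfl h
    | snoc T A =>
      refine ⟨⟨⟨_, T⟩, A⟩, rfl, ?_⟩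
      rintro ⟨⟨Z, T'⟩, A'⟩ h'
      have h₁ := Option.some.inj (congrArg (fun T : TelCtx X => T.tel.last) h')
      have h₂ := congrArg
        (fun P : Σ (Z : C) (_ : Tel X Z), LUTy Z => (⟨⟨P.1, P.2.1⟩, P.2.2⟩ :
          Σ T : TelCtx X, LUTy T.obj)) h₁
      exact h₂.symm

/-! #### Reindexing -/

/-- The result of pulling back a context with underlying object `Y` along a map into the base:
a context over the new base with a map to `Y`. -/
structure PullData (X' Y : C) where
  ctx : TelCtx X'
  top : ctx.obj ⟶ Y

/-- Reindexing of a context along `f : X' ⟶ X`: every type is substituted along the induced map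
of iterated extensions. -/
def Tel.pull {X' X : C} (f : X' ⟶ X) : {Y : C} → Tel X Y → PullData X' Y
  | _, .nil => ⟨.nil X', f⟩
  | _, .snoc T A =>
    ⟨(T.pull f).ctx.snoc (A.sub (T.pull f).top), A.q (T.pull f).top⟩

theorem PullData.snoc_congr {X' Y : C} (T : TelCtx X') {A A' : LUTy T.obj} (h : A = A')
    {m : A.ext ⟶ Y} {m' : A'.ext ⟶ Y} (h' : m = eqToHom (congrArg LUTy.ext h) ≫ m') :
    (⟨T.snoc A, m⟩ : PullData X' Y) = ⟨T.snoc A', m'⟩ := by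
  subst h
  simp [h']

theorem Tel.isPullback_pull {X' X : C} (f : X' ⟶ X) {Y : C} (T : Tel X Y) :
    IsPullback (T.pull f).top (T.pull f).ctx.tel.disp T.disp f := by
  induction T with
  | nil =>
    have : IsIso (Tel.disp (X := X) .nil) := inferInstanceAs (IsIso (𝟙 X))
    have : IsIso (Tel.pull f .nil).ctx.tel.disp := inferInstanceAs (IsIso (𝟙 X'))
    exact IsPullback.of_vert_isIso ⟨(Category.comp_id f).trans (Category.id_comp f).symm⟩
  | snoc T A ih => exact (A.isPullback_q _).paste_vert ih

theorem Tel.pull_id {X : C} {Y : C} (T : Tel X Y) : T.pull (𝟙 X) = ⟨⟨Y, T⟩, 𝟙 Y⟩ := by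
  induction T with
  | nil => rfl
  | snoc T A ih =>
    rw [Tel.pull, ih]
    exact PullData.snoc_congr ⟨_, T⟩ A.sub_id (A.q_id.trans (Category.comp_id _).symm)

theorem Tel.pull_comp {X'' X' X : C} (g : X'' ⟶ X') (f : X' ⟶ X) {Y : C} (T : Tel X Y) :
    T.pull (g ≫ f) =
      ⟨((T.pull f).ctx.tel.pull g).ctx,
        ((T.pull f).ctx.tel.pull g).top ≫ (T.pull f).top⟩ := by
  induction T with
  | nil => rfl
  | snoc T A ih =>
    rw [Tel.pull, ih]
    exact PullData.snoc_congr _ (A.sub_comp _ _) (A.q_comp _ _)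

namespace TelCtx

/-- Reindexing of a context along `f : X' ⟶ X`. -/
abbrev pull {X' X : C} (f : X' ⟶ X) (T : TelCtx X) : TelCtx X' := (T.tel.pull f).ctx

/-- The comparison map from a reindexed context. -/
abbrev top {X' X : C} (f : X' ⟶ X) (T : TelCtx X) : (T.pull f).obj ⟶ T.obj := (T.tel.pull f).top

theorem isPullback_top {X' X : C} (f : X' ⟶ X) (T : TelCtx X) :
    IsPullback (T.top f) (T.pull f).tel.disp T.tel.disp f :=
  T.tel.isPullback_pull f

/-- The action of reindexing on morphisms, given by the universal property of pullbacks. -/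
def pullMap {X' X : C} (f : X' ⟶ X) {S T : TelCtx X} (m : S ⟶ T) : S.pull f ⟶ T.pull f :=
  ⟨(T.isPullback_top f).lift (S.top f ≫ m.hom) (S.pull f).tel.disp
    (by rw [Category.assoc, m.w, (S.isPullback_top f).w]), IsPullback.lift_snd _ _ _ _⟩

theorem pullMap_top {X' X : C} (f : X' ⟶ X) {S T : TelCtx X} (m : S ⟶ T) :
    (pullMap f m).hom ≫ T.top f = S.top f ≫ m.hom :=
  IsPullback.lift_fst _ _ _ _

theorem hom_ext_top {X' X : C} (f : X' ⟶ X) {S : TelCtx X'} {T : TelCtx X} {m n : S ⟶ T.pull f}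
    (h : m.hom ≫ T.top f = n.hom ≫ T.top f) : m = n :=
  hom_ext ((T.isPullback_top f).hom_ext h (by rw [m.w, n.w]))

theorem pull_id (X : C) (T : TelCtx X) : T.pull (𝟙 X) = T := by
  rw [pull, Tel.pull_id]

theorem eqToHom_top {X' X : C} (f : X' ⟶ X) {T : TelCtx X} {P : PullData X' T.obj}
    (h : T.tel.pull f = P) :
    eqToHom (by rw [pull, h]) ≫ P.top = T.top f := by
  subst h
  simp

theorem pull_comp {X'' X' X : C} (g : X'' ⟶ X') (f : X' ⟶ X) (T : TelCtx X) :
    T.pull (g ≫ f) = (T.pull f).pull g := by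
  rw [pull, Tel.pull_comp]

theorem top_id (X : C) (T : TelCtx X) :
    T.top (𝟙 X) = eqToHom (congrArg obj (pull_id X T)) :=
  (eqToHom_top (𝟙 X) T.tel.pull_id).symm.trans (Category.comp_id _)

theorem top_comp {X'' X' X : C} (g : X'' ⟶ X') (f : X' ⟶ X) (T : TelCtx X) :
    T.top (g ≫ f) =
      eqToHom (congrArg obj (pull_comp g f T)) ≫ (T.pull f).top g ≫ T.top f :=
  (eqToHom_top (g ≫ f) (T.tel.pull_comp g f)).symm

theorem pullMap_proj {X' X : C} (f : X' ⟶ X) (T : TelCtx X) (A : LUTy T.obj) :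
    pullMap f (T.proj A) = (T.pull f).proj (A.sub (T.top f)) :=
  hom_ext_top f ((pullMap_top f _).trans (A.q_proj (T.top f)))

theorem pullMap_q {X' X : C} (f : X' ⟶ X) {S T : TelCtx X} (m : S ⟶ T) (A : LUTy T.obj)
    (h : (S.pull f).snoc ((A.sub m.hom).sub (S.top f)) =
      (S.pull f).snoc ((A.sub (T.top f)).sub (pullMap f m).hom)) :
    pullMap f (q m A) = eqToHom h ≫ q (pullMap f m) (A.sub (T.top f)) := by
  apply hom_ext_top f
  refine (pullMap_top f _).trans ?_
  rw [comp_hom (eqToHom h), eqToHom_hom h]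
  refine Eq.trans ?_ (Category.assoc _ _ _).symm
  change (A.sub m.hom).q (S.top f) ≫ A.q m.hom =
    eqToHom _ ≫ (A.sub (T.top f)).q (pullMap f m).hom ≫ A.q (T.top f)
  have h₁ := A.q_comp (S.top f) m.hom
  rw [A.q_congr (pullMap_top f m).symm, A.q_comp (pullMap f m).hom (T.top f)] at h₁
  rw [← cancel_epi (eqToHom (congrArg LUTy.ext (A.sub_comp (S.top f) m.hom))), ← h₁]
  simp

/-- Reindexing of contexts as a functor. -/
def pullFunctor {X' X : C} (f : X' ⟶ X) : TelCtx X ⥤ TelCtx X' where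
  obj T := T.pull f
  map m := pullMap f m
  map_id T := hom_ext_top f (by simp [pullMap_top])
  map_comp m n := hom_ext_top f (by simp [pullMap_top, reassoc_of% pullMap_top f m])

theorem pullMap_id {X : C} {S T : TelCtx X} (m : S ⟶ T) :
    pullMap (𝟙 X) m = eqToHom (pull_id X S) ≫ m ≫ eqToHom (pull_id X T).symm := by
  apply hom_ext_top (𝟙 X)
  rw [pullMap_top, top_id, top_id]
  simp

theorem pullMap_comp {X'' X' X : C} (g : X'' ⟶ X') (f : X' ⟶ X) {S T : TelCtx X} (m : S ⟶ T) :
    pullMap (g ≫ f) m =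
      eqToHom (pull_comp g f S) ≫ pullMap g (pullMap f m) ≫ eqToHom (pull_comp g f T).symm := by
  apply hom_ext_top (g ≫ f)
  have h₁ := pullMap_top g (pullMap f m)
  have h₂ := pullMap_top f m
  rw [pullMap_top, top_comp, top_comp]
  simp [reassoc_of% h₁, h₂]

theorem sub_top_id {X : C} (T : TelCtx X) (A : LUTy T.obj) :
    LUTy.sub (TelCtx.Hom.hom (eqToHom (pull_id X T))) A = A.sub (T.top (𝟙 X)) := by
  rw [top_id, eqToHom_hom]

theorem sub_top_comp {X'' X' X : C} (g : X'' ⟶ X') (f : X' ⟶ X) (T : TelCtx X)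
    (A : LUTy T.obj) :
    LUTy.sub (TelCtx.Hom.hom (eqToHom (pull_comp g f T)))
      (LUTy.sub ((T.pull f).top g) (LUTy.sub (T.top f) A)) = A.sub (T.top (g ≫ f)) := by
  rw [top_comp, eqToHom_hom, ← LUTy.sub_comp, ← LUTy.sub_comp, Category.assoc]

theorem pullFunctor_id (X : C) : pullFunctor (𝟙 X) = 𝟭 (TelCtx X) :=
  CategoryTheory.Functor.ext (pull_id X) (fun _ _ m => pullMap_id m)

theorem pullFunctor_comp {X'' X' X : C} (g : X'' ⟶ X') (f : X' ⟶ X) :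
    pullFunctor (g ≫ f) = pullFunctor f ⋙ pullFunctor g :=
  CategoryTheory.Functor.ext (pull_comp g f) (fun _ _ m => pullMap_comp g f m)

end TelCtx

/-- Reindexing along `f : X' ⟶ X` as a contextual functor. -/
def reindexLU {X' X : C} (f : X' ⟶ X) :
    ContextualFunctor (localUniverses X) (localUniverses X') where
  toFunctor := TelCtx.pullFunctor f
  mapTy {T} A := LUTy.sub (TelCtx.top f T) A
  obj_empty := rfl
  mapTy_sub {S T : TelCtx X} (m : TelCtx.Hom S T) (A : LUTy T.obj) := by
    change LUTy.sub _ (LUTy.sub (TelCtx.Hom.hom m) A) = LUTy.sub (TelCtx.pullMap f m).hom (LUTy.sub _ A)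
    rw [← LUTy.sub_comp, ← LUTy.sub_comp, TelCtx.pullMap_top]
  obj_ext A := rfl
  map_proj {T} A := (TelCtx.pullMap_proj f T A).trans (Category.id_comp _).symm
  map_q {S T} m A := (TelCtx.pullMap_q f m A _).trans
    (congrArg _ (Category.comp_id (TelCtx.q (TelCtx.pullMap f m) _)).symm)

variable (C) in
/-- The local universes models over the objects of `C`, with reindexing along maps of `C`. -/
def localUniversesFunctor : Cᵒᵖ ⥤ ContextualCategory.{v, max u v, max u v} where
  obj X := localUniverses X.unop
  map f := reindexLU f.unop
  map_id X := ContextualFunctor.hext (TelCtx.pullFunctor_id X.unop)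
    (fun {T} A => TelCtx.sub_top_id T A)
  map_comp f g := ContextualFunctor.hext (TelCtx.pullFunctor_comp g.unop f.unop)
    (fun {T} A => TelCtx.sub_top_comp g.unop f.unop T A)

variable (C) in
/-- The contextual category `C_!` of the local universes construction. -/
def localUniversesModel : ContextualCategory.{v, max u v, max u v} :=
  localUniverses (⊤_ C)

end LocalUniverses

/-- The change of base `F^*(C_!)`: the base is `B_!`, and the contextual category
over a context `Γ` of `B_!` is the local universes model of `C` over `F(Γ)`. -/
def changeOfBase {B : Type u₁} [Category.{v₁} B] [CatWithFib B] {C : Type u₂} [Category.{v₂} C]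
    [CatWithFib C] (F : B ⥤ C) :
    IndexedContextualCategory.{v₁, max u₁ v₁, max u₁ v₁, v₂, max u₂ v₂, max u₂ v₂} where
  base := localUniversesModel B
  indexed := (TelCtx.interp (⊤_ B) ⋙ F).op ⋙ localUniversesFunctor C

end IndexedTT

end

/-! A type of the local universes model is a map into the base of a fixed fibration, and
substitution is precomposition. A construction is therefore strictly stable once it is carried out
in a universal case and transported along classifying maps that are natural in the data. The proof
finds these universal cases with dependent products.

Formation and introduction. Let `f = F(p)`, for `p` the fibration of a base type, and let `p' : E' ⟶
V'` be the fibration of a family indexed by that type. The dependent product along `f` of the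
constant family `V'` classifies a point of the base of `f` together with a map from the fibre over
it to `V'`. The universal family over it is a fibration followed by a pullback of `f`, hence a
quasifibration. Its factorisation is the generic coproduct (`exists_genericCoproduct`): the
fibration part is the coproduct type, the trivial cofibration is the injection. Uniqueness of
classifying maps (`GenericCoproduct.base_cls`) yields stability, since the generic coproduct depends
only on the two fibrations, which substitution leaves alone.

Elimination. An eliminator is a diagonal filler of the injection against the fibration of `D`. Each
pullback of the injection is still a trivial cofibration, so fillers exist, but separately chosen
fillers need not be stable. Two further dependent products classify the type over the coproduct and
the term over the family. They give a generic problem to which every problem maps, with a unique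
base component (`ElimProblem.exists_generic`). One filler chosen there and pulled back solves all
problems naturally (`exists_solutions`).

The rest translates between contexts and `C`: a morphism of contexts is a base map together with a
map of `C` (`Underlying.hom_ext`), and a map into an extension is determined by its projection and
the generic element (`Underlying.ext_hom_ext`). Every injection factors through the injection at the
variable (`injSub_eq`), so the computation rule is needed only there. -/

noncomputable section

namespace IndexedTT

/-! ### Dependent products along exponentiable maps -/

section DependentProducts

variable {C : Type u} [Category.{v} C]

/-- A dependent product of `g : Z ⟶ X` along `f : X ⟶ Y`: an object over `Y` whose maps from
`t : T ⟶ Y` classify the maps over `X` from the pullback of `T` along `f` to `Z`. -/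
structure DependentProduct {X Y Z : C} (f : X ⟶ Y) (g : Z ⟶ X) where
  obj : C
  π : obj ⟶ Y
  tot : C
  fst : tot ⟶ X
  snd : tot ⟶ obj
  isPullback : IsPullback fst snd f π
  ev : tot ⟶ Z
  ev_comp : ev ≫ g = fst
  exists_lift : ∀ {T T' : C} (t : T ⟶ Y) (t₁ : T' ⟶ X) (t₂ : T' ⟶ T),
    IsPullback t₁ t₂ f t → ∀ z : T' ⟶ Z, z ≫ g = t₁ →
      ∃ (s : T ⟶ obj) (k : T' ⟶ tot), s ≫ π = t ∧ k ≫ snd = t₂ ≫ s ∧ k ≫ ev = z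
  hom_ext : ∀ {T T' : C} (t : T ⟶ Y) (t₁ : T' ⟶ X) (t₂ : T' ⟶ T),
    IsPullback t₁ t₂ f t → ∀ (s s' : T ⟶ obj) (k k' : T' ⟶ tot), s ≫ π = t → s' ≫ π = t →
      k ≫ snd = t₂ ≫ s → k' ≫ snd = t₂ ≫ s' → k ≫ fst = t₁ → k ≫ ev = k' ≫ ev → s = s'

/-- Pullbacks and dependent products along `f` exist. -/
def HasDependentProductsAlong {X Y : C} (f : X ⟶ Y) : Prop :=
  HasPullbacksAlong f ∧ ∀ ⦃Z : C⦄ (g : Z ⟶ X), Nonempty (DependentProduct f g)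

/-- The right adjoint of pullback supplies the object and the counit supplies the evaluation. Lifts
are adjoint transposes, and their uniqueness is injectivity of transposition. -/
theorem Exponentiable.hasDependentProductsAlong {X Y : C} {f : X ⟶ Y} (hf : Exponentiable f) :
    HasDependentProductsAlong f := by
  obtain ⟨hpb, hadj⟩ := hf
  refine ⟨hpb, fun Z g => ?_⟩
  let adj := Adjunction.ofIsLeftAdjoint (Over.pullback f)
  let R := (Over.pullback f).rightAdjoint
  let P : Over Y := R.obj (Over.mk g)
  let ε : (Over.pullback f).obj P ⟶ Over.mk g := adj.counit.app (Over.mk g)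
  have map_fst : ∀ {o o' : Over Y} (m : o ⟶ o'),
      ((Over.pullback f).map m).left ≫ pullback.fst o'.hom f = pullback.fst o.hom f ≫ m.left :=
    fun m => pullback.lift_fst _ _ _
  have map_snd : ∀ {o o' : Over Y} (m : o ⟶ o'),
      ((Over.pullback f).map m).left ≫ pullback.snd o'.hom f = pullback.snd o.hom f :=
    fun m => pullback.lift_snd _ _ _
  refine ⟨{
    obj := P.left
    π := P.hom
    tot := pullback P.hom f
    fst := pullback.snd _ _
    snd := pullback.fst _ _
    isPullback := (IsPullback.of_hasPullback _ _).flip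
    ev := ε.left
    ev_comp := Over.w ε
    exists_lift := ?_
    hom_ext := ?_ }⟩
  · intro T T' t t₁ t₂ h z hz
    -- The adjunction speaks of the chosen pullback, the universal property of an arbitrary one; `e`
    -- and `e'` compare the two.
    let e : pullback t f ⟶ T' := h.lift (pullback.snd t f) (pullback.fst t f)
      pullback.condition.symm
    let e' : T' ⟶ pullback t f := pullback.lift t₂ t₁ h.w.symm
    have he : e' ≫ e = 𝟙 _ := by
      apply h.hom_ext
      · rw [Category.assoc, h.lift_fst, Category.id_comp]
        exact pullback.lift_snd _ _ _
      · rw [Category.assoc, h.lift_snd, Category.id_comp]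
        exact pullback.lift_fst _ _ _
    have hw : (e ≫ z) ≫ g = pullback.snd t f := by
      simp [hz, e]
    let m : (Over.pullback f).obj (Over.mk t) ⟶ Over.mk g := Over.homMk (e ≫ z) hw
    let s := adj.homEquiv _ _ m
    have hs : (Over.pullback f).map s ≫ ε = m := by
      have := (adj.homEquiv_counit (X := Over.mk t) (Y := Over.mk g) (g := s)).symm
      rw [Equiv.symm_apply_apply] at this
      exact this
    refine ⟨s.left, e' ≫ ((Over.pullback f).map s).left, Over.w s, ?_, ?_⟩
    · rw [Category.assoc, map_fst]
      exact pullback.lift_fst_assoc _ _ _ _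
    · have := congrArg Over.Hom.left hs
      have h₁ : ((Over.pullback f).map s).left ≫ ε.left = e ≫ z := this
      rw [Category.assoc, h₁]
      exact (Category.assoc _ _ _).symm.trans ((congrArg (· ≫ z) he).trans (Category.id_comp _))
  · intro T T' t t₁ t₂ h s s' k k' hs hs' hk hk' hkf hev
    have hkf' : k' ≫ pullback.snd P.hom f = t₁ := by
      rw [← hkf]
      have h₁ := congrArg (· ≫ g) hev
      have h₂ : ε.left ≫ g = pullback.snd P.hom f := Over.w ε
      simpa only [Category.assoc, h₂] using h₁.symm
    let e : pullback t f ⟶ T' := h.lift (pullback.snd t f) (pullback.fst t f)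
      pullback.condition.symm
    have he₁ : e ≫ t₁ = pullback.snd t f := h.lift_fst _ _ _
    have he₂ : e ≫ t₂ = pullback.fst t f := h.lift_snd _ _ _
    let S : Over.mk t ⟶ P := Over.homMk s hs
    let S' : Over.mk t ⟶ P := Over.homMk s' hs'
    -- Its two projections force `k` to be the pullback of `S`, up to the comparison `e`. Equal
    -- evaluations thus become equal transposes.
    have key : ∀ (S : Over.mk t ⟶ P) (k : T' ⟶ pullback P.hom f),
        k ≫ pullback.fst P.hom f = t₂ ≫ S.left → k ≫ pullback.snd P.hom f = t₁ →
        ((Over.pullback f).map S).left = e ≫ k := by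
      intro S k h₁ h₂
      apply pullback.hom_ext
      · rw [map_fst, Category.assoc, h₁, reassoc_of% he₂]; rfl
      · rw [map_snd, Category.assoc, h₂, he₁]; rfl
    have : S = S' := by
      apply (adj.homEquiv _ _).symm.injective
      rw [adj.homEquiv_counit, adj.homEquiv_counit]
      apply Over.OverMorphism.ext
      rw [Over.comp_left, Over.comp_left, key S k hk hkf, key S' k' hk' hkf', Category.assoc,
        Category.assoc]
      exact congrArg (e ≫ ·) hev
    exact congrArg Over.Hom.left this

/-- The product along `h` of the product along `f` works, because pullback along the composite is an
iterated pullback. This is needed for families over an indexing map, whose projection is a fibration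
followed by an `F`-fibration and need not be either. -/
theorem HasDependentProductsAlong.comp {X Y S : C} {f : X ⟶ Y} {h : Y ⟶ S}
    (hf : HasDependentProductsAlong f) (hh : HasDependentProductsAlong h) :
    HasDependentProductsAlong (f ≫ h) := by
  have : HasPullbacksAlong f := hf.1
  have : HasPullbacksAlong h := hh.1
  refine ⟨fun {W} w => ?_, fun Z g => ?_⟩
  · exact ((IsPullback.of_hasPullback (pullback.snd w h) f).paste_horiz
      (IsPullback.of_hasPullback w h)).hasPullback
  · obtain ⟨D₁⟩ := hf.2 g
    obtain ⟨D₂⟩ := hh.2 D₁.π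
    have hR := (IsPullback.of_hasPullback D₂.fst f).flip
    have hR₁ : pullback.snd D₂.fst f ≫ f = (pullback.fst D₂.fst f ≫ D₂.ev) ≫ D₁.π := by
      rw [Category.assoc, D₂.ev_comp, hR.w]
    -- Evaluation happens in two stages: `r` applies the evaluation of `D₂` over each point of `X`,
    -- and `D₁.ev` then evaluates the result.
    let r : pullback D₂.fst f ⟶ D₁.tot := D₁.isPullback.lift _ _ hR₁
    have hr₁ : r ≫ D₁.fst = pullback.snd D₂.fst f := IsPullback.lift_fst _ _ _ _
    have hr₂ : r ≫ D₁.snd = pullback.fst D₂.fst f ≫ D₂.ev := IsPullback.lift_snd _ _ _ _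
    refine ⟨{
      obj := D₂.obj
      π := D₂.π
      tot := pullback D₂.fst f
      fst := pullback.snd _ _
      snd := pullback.fst _ _ ≫ D₂.snd
      isPullback := hR.paste_vert D₂.isPullback
      ev := r ≫ D₁.ev
      ev_comp := by rw [Category.assoc, D₁.ev_comp, hr₁]
      exists_lift := ?_
      hom_ext := ?_ }⟩
    · intro T T' t t₁ t₂ hT z hz
      have hT₂ := (IsPullback.of_hasPullback t h).flip
      let u : T' ⟶ pullback t h := hT₂.lift (t₁ ≫ f) t₂ ((Category.assoc _ _ _).trans hT.w)
      have hu₁ : u ≫ pullback.snd t h = t₁ ≫ f := hT₂.lift_fst _ _ _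
      have hu₂ : u ≫ pullback.fst t h = t₂ := hT₂.lift_snd _ _ _
      -- By pasting, `T'` is the pullback along `f` of the pullback of `T` along `h`, so `z` can be
      -- transposed first along `f` and then along `h`.
      have hT₁ : IsPullback t₁ u f (pullback.snd t h) :=
        IsPullback.of_bot (by rw [hu₂]; exact hT) hu₁.symm hT₂
      obtain ⟨s₁, k₁, hs₁, hk₁, hk₁'⟩ := D₁.exists_lift _ t₁ u hT₁ z hz
      obtain ⟨s₂, k₂, hs₂, hk₂, hk₂'⟩ := D₂.exists_lift _ _ _ hT₂ s₁ hs₁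
      have hk₂f : k₂ ≫ D₂.fst = pullback.snd t h := by
        rw [← D₂.ev_comp, reassoc_of% hk₂', hs₁]
      have hk : t₁ ≫ f = (u ≫ k₂) ≫ D₂.fst := by
        rw [Category.assoc, hk₂f, hu₁]
      have hl₁ := hR.lift_fst _ _ hk
      have hl₂ := hR.lift_snd _ _ hk
      refine ⟨s₂, hR.lift _ _ hk, hs₂, ?_, ?_⟩
      · rw [reassoc_of% hl₂, hk₂, reassoc_of% hu₂]
      · have : hR.lift _ _ hk ≫ r = k₁ := by
          apply D₁.isPullback.hom_ext
          · rw [Category.assoc, hr₁, hl₁, ← D₁.ev_comp, reassoc_of% hk₁', hz]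
          · rw [Category.assoc, hr₂, reassoc_of% hl₂, hk₂', hk₁]
        rw [reassoc_of% this, hk₁']
    · intro T T' t t₁ t₂ hT s s' k k' hs hs' hk hk' hkf hev
      have hT₂ := (IsPullback.of_hasPullback t h).flip
      let u : T' ⟶ pullback t h := hT₂.lift (t₁ ≫ f) t₂ ((Category.assoc _ _ _).trans hT.w)
      have hu₁ : u ≫ pullback.snd t h = t₁ ≫ f := hT₂.lift_fst _ _ _
      have hu₂ : u ≫ pullback.fst t h = t₂ := hT₂.lift_snd _ _ _
      have hT₁ : IsPullback t₁ u f (pullback.snd t h) :=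
        IsPullback.of_bot (by rw [hu₂]; exact hT) hu₁.symm hT₂
      have hkf' : k' ≫ pullback.snd D₂.fst f = t₁ := by
        have h₁ := congrArg (· ≫ g) hev
        simp only [Category.assoc, D₁.ev_comp, hr₁] at h₁
        rw [← h₁, hkf]
      have key : ∀ (s : T ⟶ D₂.obj) (k : T' ⟶ pullback D₂.fst f), s ≫ D₂.π = t →
          k ≫ pullback.fst D₂.fst f ≫ D₂.snd = t₂ ≫ s → k ≫ pullback.snd D₂.fst f = t₁ →
          ∃ k₂ : pullback t h ⟶ D₂.tot, k₂ ≫ D₂.fst = pullback.snd t h ∧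
            k₂ ≫ D₂.snd = pullback.fst t h ≫ s ∧ k ≫ pullback.fst D₂.fst f = u ≫ k₂ := by
        intro s k hs hk hkf
        have hw : pullback.snd t h ≫ h = (pullback.fst t h ≫ s) ≫ D₂.π := by
          rw [Category.assoc, hs, hT₂.w]
        refine ⟨D₂.isPullback.lift _ _ hw, IsPullback.lift_fst _ _ _ _,
          IsPullback.lift_snd _ _ _ _, ?_⟩
        apply D₂.isPullback.hom_ext
        · rw [Category.assoc, Category.assoc, IsPullback.lift_fst, ← hR.w, reassoc_of% hkf, hu₁]
        · rw [Category.assoc, Category.assoc, IsPullback.lift_snd, hk, reassoc_of% hu₂]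
      obtain ⟨l, hl₁, hl₂, hl₃⟩ := key s k hs hk hkf
      obtain ⟨l', hl₁', hl₂', hl₃'⟩ := key s' k' hs' hk' hkf'
      refine D₂.hom_ext t _ _ hT₂ s s' l l' hs hs' hl₂ hl₂' hl₁ ?_
      refine D₁.hom_ext (pullback.snd t h) t₁ u hT₁ _ _ (k ≫ r) (k' ≫ r) ?_ ?_ ?_ ?_ ?_ ?_
      · rw [Category.assoc, D₂.ev_comp, hl₁]
      · rw [Category.assoc, D₂.ev_comp, hl₁']
      · rw [Category.assoc, hr₂, reassoc_of% hl₃]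
      · rw [Category.assoc, hr₂, reassoc_of% hl₃']
      · rw [Category.assoc, hr₁, hkf]
      · simpa only [Category.assoc] using hev

namespace DependentProduct

variable {X Y K : C} [HasBinaryProducts C] {f : X ⟶ Y}
  (D : DependentProduct f (prod.fst : X ⨯ K ⟶ X))

/-- The evaluation of a dependent product of a constant family. -/
def evConst : D.tot ⟶ K := D.ev ≫ prod.snd

/-- A map over `X` into `X ⨯ K` is just a map into `K`, so the dependent product of a constant
family classifies unconstrained maps out of the fibres of `f`. -/
theorem exists_lift_const {T T' : C} (t : T ⟶ Y) (t₁ : T' ⟶ X) (t₂ : T' ⟶ T)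
    (h : IsPullback t₁ t₂ f t) (z : T' ⟶ K) :
    ∃ (s : T ⟶ D.obj) (k : T' ⟶ D.tot), s ≫ D.π = t ∧ k ≫ D.fst = t₁ ∧ k ≫ D.snd = t₂ ≫ s ∧
      k ≫ D.evConst = z := by
  obtain ⟨s, k, hs, hk, hk'⟩ := D.exists_lift t t₁ t₂ h (prod.lift t₁ z) (prod.lift_fst _ _)
  refine ⟨s, k, hs, ?_, hk, ?_⟩
  · rw [← D.ev_comp, reassoc_of% hk', prod.lift_fst]
  · rw [evConst, reassoc_of% hk', prod.lift_snd]

theorem hom_ext_const {T T' : C} {t₁ : T' ⟶ X} {t₂ : T' ⟶ T} {s s' : T ⟶ D.obj}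
    (h : IsPullback t₁ t₂ f (s ≫ D.π)) (k k' : T' ⟶ D.tot) (hs : s' ≫ D.π = s ≫ D.π)
    (hk : k ≫ D.snd = t₂ ≫ s) (hk' : k' ≫ D.snd = t₂ ≫ s') (hf : k ≫ D.fst = t₁)
    (hf' : k' ≫ D.fst = t₁) (hev : k ≫ D.evConst = k' ≫ D.evConst) : s = s' := by
  refine D.hom_ext _ t₁ t₂ h s s' k k' rfl hs hk hk' hf ?_
  apply Limits.prod.hom_ext
  · rw [Category.assoc, Category.assoc, D.ev_comp, hf, hf']
  · simpa only [Category.assoc, evConst] using hev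

end DependentProduct

end DependentProducts

/-! ### Generic coproducts and their generic eliminators -/

section GenericCoproducts

variable {C : Type u} [Category.{v} C] [CatWithFib C]

theorem exists_isPullback_fib {X Y Z : C} (f : X ⟶ Z) {p : Y ⟶ Z} (hp : CatWithFib.fib p) :
    ∃ (W : C) (a : W ⟶ Y) (b : W ⟶ X), IsPullback a b p f :=
  have := CatWithFib.hasPullback f p hp
  ⟨_, _, _, (IsPullback.of_hasPullback f p).flip⟩

variable [HasBinaryProducts C]

/-- The generic coproduct of a family, pulled back from `p : E ⟶ V`, indexed by a fibre of
`f : I ⟶ U`. The object `D.obj` classifies the pairs of a point of `U` and a map from the fibre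
over it to `V`; `fam` is the total space of the classified families, and `incl` a trivial
cofibration to a fibration over `D.obj`. -/
structure GenericCoproduct {I U E V : C} (f : I ⟶ U) (p : E ⟶ V) where
  D : DependentProduct f (prod.fst : I ⨯ V ⟶ I)
  fam : C
  famGen : fam ⟶ E
  famProj : fam ⟶ D.tot
  isPullback : IsPullback famGen famProj p D.evConst
  tot : C
  incl : fam ⟶ tot
  proj : tot ⟶ D.obj
  fib : CatWithFib.fib proj
  incl_proj : incl ≫ proj = famProj ≫ D.snd
  stable : ∀ ⦃X' Y' Z' : C⦄ (x : X' ⟶ fam) (y : Y' ⟶ tot) (z : Z' ⟶ D.obj) (i' : X' ⟶ Y')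
    (p' : Y' ⟶ Z'), IsPullback x i' incl y → IsPullback y p' proj z → IsTrivCof i'

/-- The universal family is a pullback of `p` followed by the pullback `D.snd` of `f`, so `hq`
factors the composite. -/
theorem exists_genericCoproduct {I U E V : C} {f : I ⟶ U} {p : E ⟶ V} (hp : CatWithFib.fib p)
    (hf : HasDependentProductsAlong f)
    (hq : ∀ ⦃X Y Z : C⦄ (q : X ⟶ Y) (g : Y ⟶ Z) (t : Y ⟶ I) (b : Z ⟶ U),
      CatWithFib.fib q → IsPullback t g f b →
        IsQuasifibration (q ≫ g)) :
    Nonempty (GenericCoproduct f p) := by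
  obtain ⟨D⟩ := hf.2 (prod.fst : I ⨯ V ⟶ I)
  have := CatWithFib.hasPullback D.evConst p hp
  have hE := (IsPullback.of_hasPullback D.evConst p).flip
  obtain ⟨Y, i, r, _, hr, hir, hst⟩ := hq (pullback.fst D.evConst p) D.snd D.fst D.π
    (CatWithFib.fib.of_isPullback hE hp) D.isPullback
  exact ⟨⟨D, _, _, _, hE, Y, i, r, hr, hir, hst⟩⟩

namespace GenericCoproduct

variable {I U E V : C} {f : I ⟶ U} {p : E ⟶ V} (G : GenericCoproduct f p) {E' V' : C}
  (p' : E' ⟶ V')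

/-- A map `base ⟶ G.D.obj`, together with a type over the pulled back coproduct (classified by
`ty`) and a term of it over the pulled back family (classified by `tm`). -/
structure ElimProblem where
  base : C
  cls : base ⟶ G.D.obj
  tot : C
  totMap : tot ⟶ G.tot
  totProj : tot ⟶ base
  isPullback_tot : IsPullback totMap totProj G.proj cls
  fam : C
  famMap : fam ⟶ G.fam
  famProj : fam ⟶ base
  isPullback_fam : IsPullback famMap famProj (G.famProj ≫ G.D.snd) cls
  incl : fam ⟶ tot
  incl_totMap : incl ≫ totMap = famMap ≫ G.incl
  incl_totProj : incl ≫ totProj = famProj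
  ty : tot ⟶ V'
  tm : fam ⟶ E'
  w : incl ≫ ty = tm ≫ p'

namespace ElimProblem

variable {G p'}

/-- Morphisms of elimination problems. -/
structure Hom (P Q : ElimProblem G p') where
  base : P.base ⟶ Q.base
  tot : P.tot ⟶ Q.tot
  fam : P.fam ⟶ Q.fam
  base_cls : base ≫ Q.cls = P.cls
  tot_totMap : tot ≫ Q.totMap = P.totMap
  tot_totProj : tot ≫ Q.totProj = P.totProj ≫ base
  fam_famMap : fam ≫ Q.famMap = P.famMap
  fam_famProj : fam ≫ Q.famProj = P.famProj ≫ base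
  tot_ty : tot ≫ Q.ty = P.ty
  fam_tm : fam ≫ Q.tm = P.tm

/-- Compatibility with the injections need not be a field of `Hom`: `Q.tot` is a pullback, and the
two composites agree after both of its projections. -/
theorem Hom.incl_tot {P Q : ElimProblem G p'} (h : Hom P Q) :
    P.incl ≫ h.tot = h.fam ≫ Q.incl := by
  apply Q.isPullback_tot.hom_ext
  · rw [Category.assoc, Category.assoc, h.tot_totMap, Q.incl_totMap, P.incl_totMap,
      reassoc_of% h.fam_famMap]
  · rw [Category.assoc, Category.assoc, h.tot_totProj, Q.incl_totProj,
      reassoc_of% P.incl_totProj, h.fam_famProj]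

/-- Cancelling the pullback square of the coproducts from that of the families shows that `P.incl`
is a pullback of `G.incl` of the kind that the quasifibration condition controls. -/
theorem isTrivCof_incl (P : ElimProblem G p') : IsTrivCof P.incl := by
  refine G.stable P.famMap P.totMap P.cls P.incl P.totProj ?_ P.isPullback_tot
  refine IsPullback.of_bot ?_ P.incl_totMap.symm P.isPullback_tot
  rw [P.incl_totProj, G.incl_proj]
  exact P.isPullback_fam

theorem exists_solution (hp' : CatWithFib.fib p') (P : ElimProblem G p') :
    ∃ l : P.tot ⟶ E', P.incl ≫ l = P.tm ∧ l ≫ p' = P.ty := by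
  have := P.isTrivCof_incl p' hp'
  have sq : CommSq P.tm P.incl p' P.ty := ⟨P.w.symm⟩
  exact ⟨sq.lift, sq.fac_left, sq.fac_right⟩

/-- A weakly terminal elimination problem whose incoming morphisms are determined. -/
theorem exists_generic (hp : CatWithFib.fib p) (hp' : CatWithFib.fib p')
    (hfib : ∀ ⦃X Y : C⦄ (g : X ⟶ Y), CatWithFib.fib g → HasDependentProductsAlong g)
    (hf : ∀ ⦃X Y : C⦄ (g : X ⟶ Y) (t : X ⟶ I) (b : Y ⟶ U), IsPullback t g f b →
      HasDependentProductsAlong g) :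
    ∃ W : ElimProblem G p', (∀ P, Nonempty (Hom P W)) ∧
      ∀ P (a b : Hom P W), a.base = b.base := by
  -- `A.obj` classifies a point of `G.D.obj` with a type over the coproduct at that point.
  obtain ⟨A⟩ := (hfib G.proj G.fib).2 (prod.fst : G.tot ⨯ V' ⟶ G.tot)
  obtain ⟨P₁, a₁, a₂, hP⟩ : ∃ (P₁ : C) (a₁ : P₁ ⟶ G.D.tot) (a₂ : P₁ ⟶ A.obj),
      IsPullback a₁ a₂ G.D.snd A.π := by
    have : HasPullbacksAlong G.D.snd := (hf _ _ _ G.D.isPullback).1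
    exact ⟨_, _, _, (IsPullback.of_hasPullback A.π G.D.snd).flip⟩
  have hfp : CatWithFib.fib G.famProj := CatWithFib.fib.of_isPullback G.isPullback hp
  obtain ⟨E₁, b₁, b₂, hE⟩ := exists_isPullback_fib a₁ hfp
  have hEP := hE.paste_vert hP
  -- The family over `A.obj` is built in two steps so that its projection is visibly a pullback of a
  -- fibration followed by a pullback of `f`.
  have he₁ : HasDependentProductsAlong (b₂ ≫ a₂) :=
    (hfib _ (CatWithFib.fib.of_isPullback hE hfp)).comp
      (hf _ _ _ (hP.paste_horiz G.D.isPullback))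
  generalize b₂ ≫ a₂ = e₁ at he₁ hEP
  have hj : (b₁ ≫ G.incl) ≫ G.proj = e₁ ≫ A.π := by
    rw [Category.assoc, G.incl_proj, hEP.w]
  obtain ⟨j₁, hj₁, hj₂⟩ : ∃ j₁ : E₁ ⟶ A.tot, j₁ ≫ A.fst = b₁ ≫ G.incl ∧ j₁ ≫ A.snd = e₁ :=
    ⟨A.isPullback.lift _ _ hj, IsPullback.lift_fst _ _ _ _, IsPullback.lift_snd _ _ _ _⟩
  -- A point of `Z` is a point of the family with an element of the type that `A` assigns to its
  -- injection. Sections of `z₁` over the fibres of `e₁` are thus the terms `d`, and `W.obj`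
  -- classifies the complete data.
  obtain ⟨Z, z₂, z₁, hZ'⟩ := exists_isPullback_fib (j₁ ≫ A.evConst) hp'
  have hZ := hZ'.flip
  obtain ⟨W⟩ := he₁.2 z₁
  have hAs : CatWithFib.fib A.snd := CatWithFib.fib.of_isPullback A.isPullback G.fib
  -- `Y` is the coproduct pulled back to `W.obj`, and `inc` below is its injection.
  obtain ⟨Y, y₁, y₂, hY⟩ := exists_isPullback_fib W.π hAs
  have hinc : (W.fst ≫ j₁) ≫ A.snd = W.snd ≫ W.π := by
    rw [Category.assoc, hj₂, W.isPullback.w]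
  obtain ⟨inc, hinc₁, hinc₂⟩ : ∃ inc : W.tot ⟶ Y, inc ≫ y₁ = W.fst ≫ j₁ ∧ inc ≫ y₂ = W.snd :=
    ⟨hY.lift _ _ hinc, IsPullback.lift_fst _ _ _ _, IsPullback.lift_snd _ _ _ _⟩
  refine ⟨{
    base := W.obj
    cls := W.π ≫ A.π
    tot := Y
    totMap := y₁ ≫ A.fst
    totProj := y₂
    isPullback_tot := hY.paste_horiz A.isPullback
    fam := W.tot
    famMap := W.fst ≫ b₁
    famProj := W.snd
    isPullback_fam := W.isPullback.paste_horiz hEP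
    incl := inc
    incl_totMap := by rw [reassoc_of% hinc₁, hj₁, Category.assoc]
    incl_totProj := hinc₂
    ty := y₁ ≫ A.evConst
    tm := W.ev ≫ z₂
    w := by
      rw [reassoc_of% hinc₁, Category.assoc, ← hZ.w, reassoc_of% W.ev_comp] }, ?_, ?_⟩
  · intro P
    obtain ⟨s₁, k₁, hs₁, hk₁, hk₁', hk₁v⟩ :=
      A.exists_lift_const P.cls P.totMap P.totProj P.isPullback_tot P.ty
    have hl : P.famMap ≫ G.famProj ≫ G.D.snd = (P.famProj ≫ s₁) ≫ A.π := by
      rw [Category.assoc, hs₁, P.isPullback_fam.w]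
    have hl₁ := hEP.lift_fst _ _ hl
    have hl₂ := hEP.lift_snd _ _ hl
    set l := hEP.lift _ _ hl
    have hlP : IsPullback l P.famProj e₁ s₁ :=
      IsPullback.of_right (by rw [hl₁, hs₁]; exact P.isPullback_fam) hl₂ hEP
    -- The injection of `P` matches the one over `A.obj`; therefore the term of `P` lies over the
    -- classified type and defines a map to `Z`.
    have hlj : l ≫ j₁ = P.incl ≫ k₁ := by
      apply A.isPullback.hom_ext
      · rw [Category.assoc, Category.assoc, hj₁, reassoc_of% hl₁, hk₁, P.incl_totMap]
      · rw [Category.assoc, Category.assoc, hj₂, hl₂, hk₁', reassoc_of% P.incl_totProj]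
    have hz : l ≫ j₁ ≫ A.evConst = P.tm ≫ p' := by
      rw [reassoc_of% hlj, hk₁v, P.w]
    obtain ⟨s, k, hs, hk, hk'⟩ := W.exists_lift s₁ l P.famProj hlP _ (hZ.lift_fst _ _ hz)
    have hkf : k ≫ W.fst = l := by
      rw [← W.ev_comp, reassoc_of% hk', hZ.lift_fst]
    have hy : k₁ ≫ A.snd = (P.totProj ≫ s) ≫ W.π := by
      rw [Category.assoc, hs, hk₁']
    have hy₁ := hY.lift_fst _ _ hy
    have hy₂ := hY.lift_snd _ _ hy
    refine ⟨⟨s, hY.lift _ _ hy, k, ?_, ?_, hy₂, ?_, hk, ?_, ?_⟩⟩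
    · dsimp only; rw [reassoc_of% hs, hs₁]
    · dsimp only; rw [reassoc_of% hy₁, hk₁]
    · dsimp only; rw [reassoc_of% hkf, hl₁]
    · dsimp only; rw [reassoc_of% hy₁, hk₁v]
    · dsimp only; rw [reassoc_of% hk', hZ.lift_snd]
  · rintro P ⟨aB, aT, aF, ha₁, ha₂, ha₃, ha₄, ha₅, ha₆, ha₇⟩
      ⟨bB, bT, bF, hb₁, hb₂, hb₃, hb₄, hb₅, hb₆, hb₇⟩
    dsimp only at aB aT aF bB bT bF ha₁ ha₂ ha₃ ha₄ ha₅ ha₆ ha₇ hb₁ hb₂ hb₃ hb₄ hb₅ hb₆ hb₇ ⊢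
    -- Uniqueness for `A` first identifies the classified types. Both base maps then lie over one
    -- map to `A.obj`, and uniqueness for `W` reduces the goal to the terms.
    have hs : aB ≫ W.π = bB ≫ W.π := by
      refine A.hom_ext_const (t₁ := P.totMap) (t₂ := P.totProj) ?_ (aT ≫ y₁)
        (bT ≫ y₁) ?_ ?_ ?_ ?_ ?_ ?_
      · rw [Category.assoc, ha₁]; exact P.isPullback_tot
      · rw [Category.assoc, Category.assoc, hb₁, ha₁]
      · rw [Category.assoc, hY.w, reassoc_of% ha₃]
      · rw [Category.assoc, hY.w, reassoc_of% hb₃]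
      · rw [Category.assoc, ha₂]
      · rw [Category.assoc, hb₂]
      · rw [Category.assoc, Category.assoc, ha₆, hb₆]
    have hfst : aF ≫ W.fst = bF ≫ W.fst := by
      apply hEP.hom_ext
      · rw [Category.assoc, Category.assoc, ha₄, hb₄]
      · rw [Category.assoc, Category.assoc, W.isPullback.w, reassoc_of% ha₅, reassoc_of% hb₅, hs]
    refine W.hom_ext (aB ≫ W.π) (aF ≫ W.fst) P.famProj ?_ aB bB aF bF rfl
      hs.symm ha₅ hb₅ rfl ?_
    · refine IsPullback.of_right ?_ ?_ hEP
      · rw [Category.assoc, Category.assoc, ha₄, ha₁]; exact P.isPullback_fam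
      · rw [Category.assoc, W.isPullback.w, reassoc_of% ha₅]
    · apply hZ.hom_ext
      · rw [Category.assoc, Category.assoc, W.ev_comp, hfst]
      · rw [Category.assoc, Category.assoc, ha₇, hb₇]

/-- Solutions of all elimination problems for `G` and `p'`, natural in the problem. -/
structure Solutions (G : GenericCoproduct f p) (p' : E' ⟶ V') where
  sol : ∀ P : ElimProblem G p', P.tot ⟶ E'
  incl_sol : ∀ P, P.incl ≫ sol P = P.tm
  sol_comp : ∀ P, sol P ≫ p' = P.ty
  hom_sol : ∀ {P Q : ElimProblem G p'} (h : Hom P Q), h.tot ≫ sol Q = sol P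

/-- The filler of the generic problem is chosen once and pulled back along arbitrary morphisms `c
P`. Their choice does not affect naturality: the base component is unique, and it determines the
component on `tot` because `W.tot` is a pullback. -/
theorem exists_solutions (hp : CatWithFib.fib p) (hp' : CatWithFib.fib p')
    (hfib : ∀ ⦃X Y : C⦄ (g : X ⟶ Y), CatWithFib.fib g → HasDependentProductsAlong g)
    (hf : ∀ ⦃X Y : C⦄ (g : X ⟶ Y) (t : X ⟶ I) (b : Y ⟶ U), IsPullback t g f b →
      HasDependentProductsAlong g) :
    Nonempty (Solutions G p') := by
  obtain ⟨W, hW, hW'⟩ := exists_generic (G := G) hp hp' hfib hf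
  obtain ⟨l, hl₁, hl₂⟩ := W.exists_solution hp'
  let c : ∀ P, Hom P W := fun P => Classical.choice (hW P)
  refine ⟨⟨fun P => (c P).tot ≫ l, fun P => ?_, fun P => ?_, fun {P Q} h => ?_⟩⟩
  · rw [reassoc_of% (c P).incl_tot, hl₁, (c P).fam_tm]
  · rw [Category.assoc, hl₂, (c P).tot_ty]
  · have hc : h.base ≫ (c Q).base = (c P).base := by
      refine hW' P ⟨h.base ≫ (c Q).base, h.tot ≫ (c Q).tot, h.fam ≫ (c Q).fam, ?_, ?_, ?_, ?_,
        ?_, ?_, ?_⟩ (c P)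
      · rw [Category.assoc, (c Q).base_cls, h.base_cls]
      · rw [Category.assoc, (c Q).tot_totMap, h.tot_totMap]
      · rw [Category.assoc, (c Q).tot_totProj, reassoc_of% h.tot_totProj]
      · rw [Category.assoc, (c Q).fam_famMap, h.fam_famMap]
      · rw [Category.assoc, (c Q).fam_famProj, reassoc_of% h.fam_famProj]
      · rw [Category.assoc, (c Q).tot_ty, h.tot_ty]
      · rw [Category.assoc, (c Q).fam_tm, h.fam_tm]
    have : h.tot ≫ (c Q).tot = (c P).tot := by
      apply W.isPullback_tot.hom_ext
      · rw [Category.assoc, (c Q).tot_totMap, h.tot_totMap, (c P).tot_totMap]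
      · rw [Category.assoc, (c Q).tot_totProj, reassoc_of% h.tot_totProj, hc,
          (c P).tot_totProj]
    rw [← Category.assoc, this]

end ElimProblem

end GenericCoproduct

end GenericCoproducts

theorem comp_comp_comp_eq {C : Type u} [Category.{v} C] {A₁ A₂ A₃ A₄ A₅ A₆ A₇ : C} (α : A₁ ⟶ A₂) {β : A₂ ⟶ A₃} {γ : A₃ ⟶ A₄}
    {τ : A₄ ⟶ A₅} {σ : A₃ ⟶ A₆} {ρ : A₆ ⟶ A₅} {μ : A₂ ⟶ A₇} {ν : A₇ ⟶ A₆} (h : β ≫ σ = μ ≫ ν)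
    (h' : γ ≫ τ = σ ≫ ρ) : (α ≫ β ≫ γ) ≫ τ = (α ≫ μ) ≫ ν ≫ ρ := by
  rw [Category.assoc, Category.assoc, h', reassoc_of% h, Category.assoc]

/-! ### Classifying maps of families and their naturality -/

section GenericCoproducts

variable {C : Type u} [Category.{v} C] [CatWithFib C]

/-- A map `cls : base ⟶ U` together with a family of points of `V` over the fibre of `f`
that it classifies. -/
structure ClassifiedFamily {I U : C} (f : I ⟶ U) (V : C) where
  base : C
  cls : base ⟶ U
  tot : C
  fst : tot ⟶ I
  snd : tot ⟶ base
  isPullback : IsPullback fst snd f cls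
  ty : tot ⟶ V

/-- Morphisms of classified families. -/
structure ClassifiedFamily.Hom {I U V : C} {f : I ⟶ U} (P Q : ClassifiedFamily f V) where
  base : P.base ⟶ Q.base
  tot : P.tot ⟶ Q.tot
  base_cls : base ≫ Q.cls = P.cls
  tot_fst : tot ≫ Q.fst = P.fst
  tot_snd : tot ≫ Q.snd = P.snd ≫ base
  tot_ty : tot ≫ Q.ty = P.ty

namespace GenericCoproduct

variable [HasBinaryProducts C] {I U E V : C} {f : I ⟶ U} {p : E ⟶ V} (G : GenericCoproduct f p)

theorem exists_cls (P : ClassifiedFamily f V) :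
    ∃ m : (P.base ⟶ G.D.obj) × (P.tot ⟶ G.D.tot), m.1 ≫ G.D.π = P.cls ∧ m.2 ≫ G.D.fst = P.fst ∧
      m.2 ≫ G.D.snd = P.snd ≫ m.1 ∧ m.2 ≫ G.D.evConst = P.ty :=
  have ⟨s, k, h⟩ := G.D.exists_lift_const P.cls P.fst P.snd P.isPullback P.ty
  ⟨⟨s, k⟩, h⟩

/-- The classifying map of a family. -/
def cls (P : ClassifiedFamily f V) : P.base ⟶ G.D.obj := (G.exists_cls P).choose.1

/-- The map of total spaces over the classifying map. -/
def clsTot (P : ClassifiedFamily f V) : P.tot ⟶ G.D.tot := (G.exists_cls P).choose.2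

theorem cls_π (P : ClassifiedFamily f V) : G.cls P ≫ G.D.π = P.cls :=
  (G.exists_cls P).choose_spec.1

theorem clsTot_fst (P : ClassifiedFamily f V) : G.clsTot P ≫ G.D.fst = P.fst :=
  (G.exists_cls P).choose_spec.2.1

theorem clsTot_snd (P : ClassifiedFamily f V) : G.clsTot P ≫ G.D.snd = P.snd ≫ G.cls P :=
  (G.exists_cls P).choose_spec.2.2.1

theorem clsTot_ev (P : ClassifiedFamily f V) : G.clsTot P ≫ G.D.evConst = P.ty :=
  (G.exists_cls P).choose_spec.2.2.2

variable {G} in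
-- Although `cls` is obtained by choice, the universal property makes it unique. This equality is
-- what turns stability of the formation rule into a strict equation.
theorem base_cls {P Q : ClassifiedFamily f V} (h : P.Hom Q) : h.base ≫ G.cls Q = G.cls P := by
  refine (G.D.hom_ext_const (t₁ := P.fst) (t₂ := P.snd) ?_ (G.clsTot P) (h.tot ≫ G.clsTot Q)
    ?_ (G.clsTot_snd P) ?_ (G.clsTot_fst P) ?_ ?_).symm
  · rw [G.cls_π]; exact P.isPullback
  · rw [Category.assoc, G.cls_π, G.cls_π, h.base_cls]
  · rw [Category.assoc, G.clsTot_snd, reassoc_of% h.tot_snd]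
  · rw [Category.assoc, G.clsTot_fst, h.tot_fst]
  · rw [Category.assoc, G.clsTot_ev, G.clsTot_ev, h.tot_ty]

variable {G} in
theorem tot_clsTot {P Q : ClassifiedFamily f V} (h : P.Hom Q) :
    h.tot ≫ G.clsTot Q = G.clsTot P := by
  apply G.D.isPullback.hom_ext
  · rw [Category.assoc, G.clsTot_fst, G.clsTot_fst, h.tot_fst]
  · rw [Category.assoc, G.clsTot_snd, G.clsTot_snd, reassoc_of% h.tot_snd, base_cls h]

theorem isPullback_clsTot (P : ClassifiedFamily f V) :
    IsPullback (G.clsTot P) P.snd G.D.snd (G.cls P) := by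
  refine IsPullback.of_right ?_ (G.clsTot_snd P) G.D.isPullback
  rw [G.clsTot_fst, G.cls_π]
  exact P.isPullback

section Fam

variable (P : ClassifiedFamily f V) {T : C} {a : T ⟶ E} {b : T ⟶ P.tot}
  (h : IsPullback a b p P.ty)

/-- The map from the total space of a classified family of types to the generic one. -/
def famMap : T ⟶ G.fam :=
  G.isPullback.lift a (b ≫ G.clsTot P) (by rw [Category.assoc, G.clsTot_ev, h.w])

theorem famMap_famGen : G.famMap P h ≫ G.famGen = a :=
  IsPullback.lift_fst _ _ _ _

theorem famMap_famProj : G.famMap P h ≫ G.famProj = b ≫ G.clsTot P :=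
  IsPullback.lift_snd _ _ _ _

theorem famMap_incl_proj : (G.famMap P h ≫ G.incl) ≫ G.proj = (b ≫ P.snd) ≫ G.cls P := by
  rw [Category.assoc, G.incl_proj, reassoc_of% G.famMap_famProj P h, G.clsTot_snd, Category.assoc]

/-- Pasting exhibits the total space of the family as the pullback of the universal one along the
classifying map, as an elimination problem requires. -/
theorem isPullback_famMap :
    IsPullback (G.famMap P h) (b ≫ P.snd) (G.famProj ≫ G.D.snd) (G.cls P) := by
  refine IsPullback.paste_vert ?_ (G.isPullback_clsTot P)
  refine IsPullback.of_right ?_ (G.famMap_famProj P h) G.isPullback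
  rw [G.famMap_famGen, G.clsTot_ev]
  exact h

variable {G P} in
theorem comp_famMap {Q : ClassifiedFamily f V} (m : P.Hom Q) {T' : C} {a' : T' ⟶ E}
    {b' : T' ⟶ Q.tot} (h' : IsPullback a' b' p Q.ty) (k : T ⟶ T') (hka : k ≫ a' = a)
    (hkb : k ≫ b' = b ≫ m.tot) : k ≫ G.famMap Q h' = G.famMap P h := by
  apply G.isPullback.hom_ext
  · rw [Category.assoc, G.famMap_famGen, G.famMap_famGen, hka]
  · rw [Category.assoc, G.famMap_famProj, G.famMap_famProj, reassoc_of% hkb, tot_clsTot m]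

end Fam

end GenericCoproduct

end GenericCoproducts

/-! ### Underlying maps of the contexts of a change of base -/

section ChangeOfBase

variable {B : Type u₁} [Category.{v₁} B] [CatWithFib B] {C : Type u₂} [Category.{v₂} C]
  [CatWithFib C] {F : B ⥤ C}

open IndexedContextualCategory MCtx

namespace Underlying

/-- The underlying object of the base component of a context. -/
def baseObj (X : (changeOfBase F).MCtx) : B := TelCtx.obj (X := ⊤_ B) X.base

/-- The indexed component of a context. -/
def idx (X : (changeOfBase F).MCtx) : TelCtx (F.obj (baseObj X)) := X.idx

/-- The underlying object of a context. -/
abbrev obj (X : (changeOfBase F).MCtx) : C := (idx X).obj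

/-- The display map of a context. -/
def disp (X : (changeOfBase F).MCtx) : obj X ⟶ F.obj (baseObj X) := (idx X).tel.disp

variable {X Y Z : (changeOfBase F).MCtx}

/-- The underlying map of the base component of a morphism of contexts. -/
def baseMap (f : X ⟶ Y) : baseObj X ⟶ baseObj Y := TelCtx.Hom.hom (X := ⊤_ B) f.base

/-- The indexed component of a morphism of contexts. -/
def idxHom (f : X ⟶ Y) : TelCtx.Hom (idx X) ((idx Y).pull (F.map (baseMap f))) := f.idx

/-- The underlying map of a morphism of contexts. -/
def map (f : X ⟶ Y) : obj X ⟶ obj Y := (idxHom f).hom ≫ (idx Y).top (F.map (baseMap f))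

theorem baseMap_comp (f : X ⟶ Y) (g : Y ⟶ Z) : baseMap (f ≫ g) = baseMap f ≫ baseMap g := rfl

theorem map_disp (f : X ⟶ Y) : map f ≫ disp Y = disp X ≫ F.map (baseMap f) := by
  have h := (idxHom f).w
  rw [map, disp, disp, ← h, Category.assoc, Category.assoc]
  exact congrArg _ ((idx Y).isPullback_top (F.map (baseMap f))).w

/-- A reindexed context is a pullback, and its other projection is fixed for maps of contexts over
the base. Equations involving transports thereby reduce to equations of maps in `B` and `C`. -/
theorem hom_ext {f g : X ⟶ Y} (hb : baseMap f = baseMap g) (h : map f = map g) : f = g := by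
  obtain ⟨fb, fi⟩ := f
  obtain ⟨gb, gi⟩ := g
  have hb' : fb = gb := TelCtx.hom_ext (X := ⊤_ B) hb
  subst hb'
  have : fi = gi := TelCtx.hom_ext_top (F.map (TelCtx.Hom.hom (X := ⊤_ B) fb)) h
  rw [this]

/-- The comparison map absorbs the transport. Keeping `g` a variable allows `F.map (𝟙 _)`, equal to
an identity only propositionally, to be substituted. -/
theorem eqToHom_top_id {S : C} (T : TelCtx S) (g : S ⟶ S) (hg : g = 𝟙 S) (h : T = T.pull g) :
    (TelCtx.Hom.hom (eqToHom h)) ≫ T.top g = 𝟙 T.obj := by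
  subst hg
  rw [TelCtx.top_id, TelCtx.eqToHom_hom]
  simp

theorem eqToHom_top_comp {S₁ S₂ S₃ : C} (T : TelCtx S₃) (g : S₁ ⟶ S₂) (f : S₂ ⟶ S₃)
    (k : S₁ ⟶ S₃) (hk : k = g ≫ f) (h : (T.pull f).pull g = T.pull k) :
    (TelCtx.Hom.hom (eqToHom h)) ≫ T.top k = (T.pull f).top g ≫ T.top f := by
  subst hk
  rw [TelCtx.top_comp, TelCtx.eqToHom_hom]
  simp

theorem map_id (X : (changeOfBase F).MCtx) : map (𝟙 X) = 𝟙 _ :=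
  eqToHom_top_id (idx X) _ (F.map_id _) ((changeOfBase F).reindex_id_obj X.idx).symm

theorem map_comp (f : X ⟶ Y) (g : Y ⟶ Z) : map (f ≫ g) = map f ≫ map g := by
  have h₁ := eqToHom_top_comp (idx Z) (F.map (baseMap f)) (F.map (baseMap g))
    (F.map (baseMap (f ≫ g))) (F.map_comp _ _)
    ((changeOfBase F).reindex_comp_obj f.base g.base Z.idx).symm
  have h₂ := TelCtx.pullMap_top (F.map (baseMap f)) (idxHom g)
  exact comp_comp_comp_eq _ h₂ h₁

end Underlying

end ChangeOfBase

/-! ### Types, terms and families of a change of base, seen in `C` -/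

section ChangeOfBase

variable {B : Type u₁} [Category.{v₁} B] [CatWithFib B] {C : Type u₂} [Category.{v₂} C]
  [CatWithFib C] {F : B ⥤ C}

open IndexedContextualCategory MCtx

namespace Underlying

variable {X Y Z : (changeOfBase F).MCtx}

/-- The morphism of contexts with given base component and given underlying map. -/
def mkHom (b : X.base ⟶ Y.base) (m : obj X ⟶ obj Y)
    (w : m ≫ disp Y = disp X ≫ F.map (TelCtx.Hom.hom (X := ⊤_ B) b)) : X ⟶ Y :=
  ⟨b, ⟨((idx Y).isPullback_top _).lift m (disp X) w, IsPullback.lift_snd _ _ _ _⟩⟩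

theorem map_mkHom (b : X.base ⟶ Y.base) (m : obj X ⟶ obj Y)
    (w : m ≫ disp Y = disp X ≫ F.map (TelCtx.Hom.hom (X := ⊤_ B) b)) :
    map (mkHom b m w) = m :=
  IsPullback.lift_fst _ _ _ _

theorem map_disp_map (f : X ⟶ Y) {V : B} (g : baseObj Y ⟶ V) :
    map f ≫ disp Y ≫ F.map g = disp X ≫ F.map (baseMap f ≫ g) := by
  rw [F.map_comp, ← Category.assoc, map_disp, Category.assoc]

/-- A type as a diagram in `C`. -/
def ty (A : X.Ty) : LUTy (obj X) := A

/-- A base type as a diagram in `B`. -/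
def baseTy (I : X.BTy) : LUTy (baseObj X) := I

/-- Reindexing followed by substitution is a double precomposition, so only associativity is at
stake; the fibration is literally the same on both sides. -/
theorem ty_sub (f : X ⟶ Y) (A : Y.Ty) : ty (MCtx.sub f A) = (ty A).sub (map f) :=
  congrArg (LUTy.mk _ _ _ (ty A).fib) (Category.assoc _ _ _).symm

theorem r_sub (f : X ⟶ Y) (A : Y.Ty) : (ty (MCtx.sub f A)).r = map f ≫ (ty A).r :=
  (Category.assoc _ _ _).symm

/-- The generic element of the extension of a context by a type. -/
def gen (A : X.Ty) : obj (X.ext A) ⟶ (ty A).E := (ty A).gen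

theorem map_proj (A : X.Ty) : map (MCtx.proj A) = (ty A).proj := by
  have h := eqToHom_top_id (idx X) _ (F.map_id _) ((changeOfBase F).reindex_id_obj X.idx).symm
  exact (Category.assoc _ _ _).trans ((congrArg ((ty A).proj ≫ ·) h).trans (Category.comp_id _))

theorem disp_ext (A : X.Ty) : disp (X.ext A) = map (MCtx.proj A) ≫ disp X := by
  rw [map_proj]
  rfl

theorem isPullback_gen (A : X.Ty) :
    IsPullback (gen A) (map (MCtx.proj A)) (ty A).p (ty A).r := by
  rw [map_proj]
  exact (ty A).isPullback_ext

theorem map_q_gen (f : X ⟶ Y) (A : Y.Ty) :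
    map (MCtx.q f A) ≫ gen A = (gen (MCtx.sub f A) : _ ⟶ (ty A).E) := by
  have h₁ := (ty A).q_gen ((idx Y).top (F.map (baseMap f)))
  have h₂ := ((ty A).sub ((idx Y).top (F.map (baseMap f)))).q_gen (idxHom f).hom
  have h : map (MCtx.q f A) = ((ty A).sub ((idx Y).top (F.map (baseMap f)))).q (idxHom f).hom ≫
      (ty A).q ((idx Y).top (F.map (baseMap f))) :=
    congrArg (· ≫ _) (Category.comp_id _)
  exact (congrArg (· ≫ _) h).trans
    ((Category.assoc _ _ _).trans ((congrArg (_ ≫ ·) h₁).trans h₂))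

theorem map_wproj (X : (changeOfBase F).MCtx) (I : X.BTy) :
    map (wproj X I) = (idx X).top (F.map (baseTy I).proj) :=
  Category.id_comp _

theorem baseMap_wmap_gen (f : X ⟶ Y) (I : Y.BTy) :
    baseMap (wmap f I) ≫ (baseTy I).gen = ((baseTy (bsub f I)).gen : _ ⟶ (baseTy I).E) :=
  LUTy.q_gen (baseMap f) (baseTy I)

theorem isPullback_wproj (X : (changeOfBase F).MCtx) (I : X.BTy) :
    IsPullback (disp (X.weaken I)) (map (wproj X I)) (F.map (baseTy I).proj) (disp X) := by
  rw [map_wproj]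
  exact ((idx X).isPullback_top _).flip

/-- The projection is the identity on base contexts and a pullback projection in `C`. The equations
between terms below are checked through these two components. -/
theorem ext_hom_ext {A : Y.Ty} {f g : X ⟶ Y.ext A} (h : f ≫ MCtx.proj A = g ≫ MCtx.proj A)
    (h' : map f ≫ gen A = map g ≫ gen A) : f = g := by
  apply hom_ext
  · have := congrArg baseMap h
    rw [baseMap_comp, baseMap_comp] at this
    exact (Category.comp_id _).symm.trans (this.trans (Category.comp_id _))
  · apply (isPullback_gen A).hom_ext h'
    rw [← map_comp, ← map_comp, h]

theorem eqToHom_proj {A A' : X.Ty} (h : A = A') :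
    eqToHom (congrArg X.ext h) ≫ MCtx.proj A' = MCtx.proj A := by
  subst h
  exact Category.id_comp _

/-- Both types share `V`, `E` and `p`, so the generic elements have a common codomain and the
equation of types reduces to `r = r'`. -/
theorem map_eqToHom_gen {V E : C} {p : E ⟶ V} {hp : CatWithFib.fib p} {r r' : obj X ⟶ V}
    (h : (LUTy.mk V E p hp r : X.Ty) = (LUTy.mk V E p hp r' : LUTy (obj X))) :
    map (eqToHom (congrArg X.ext h)) ≫ gen (X := X) (LUTy.mk V E p hp r') =
      gen (X := X) (LUTy.mk V E p hp r) := by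
  obtain rfl : r = r' := by
    injection h
  exact (congrArg (· ≫ _) (map_id _)).trans (Category.id_comp _)

theorem map_comp_q_gen (f : Y ⟶ Z) (A : Z.Ty) (k : X ⟶ Y.ext (MCtx.sub f A)) :
    map (k ≫ MCtx.q f A) ≫ gen A = (map k ≫ gen (MCtx.sub f A) : _ ⟶ (ty A).E) := by
  rw [map_comp, Category.assoc, map_q_gen]

/-- Each canonical map preserves the generic element, so only the composite substitution matters and
not how it is factored. -/
theorem eqToHom_q_q {W : (changeOfBase F).MCtx} {f : X ⟶ Y} {g : Y ⟶ Z} {f' : X ⟶ W}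
    {g' : W ⟶ Z} (h : f ≫ g = f' ≫ g') (A : Z.Ty)
    (e : MCtx.sub f (MCtx.sub g A) = MCtx.sub f' (MCtx.sub g' A)) :
    eqToHom (congrArg X.ext e) ≫ MCtx.q f' (MCtx.sub g' A) ≫ MCtx.q g' A =
      MCtx.q f (MCtx.sub g A) ≫ MCtx.q g A := by
  apply ext_hom_ext
  · rw [Category.assoc, Category.assoc, Category.assoc, MCtx.q_proj, MCtx.q_proj,
      reassoc_of% MCtx.q_proj f', reassoc_of% MCtx.q_proj f, reassoc_of% eqToHom_proj e, h]
  · refine Eq.trans ?_ ((map_comp_q_gen g A _).trans (map_q_gen f (MCtx.sub g A))).symm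
    refine Eq.trans ?_ (map_eqToHom_gen e)
    rw [← Category.assoc]
    exact (map_comp_q_gen g' A _).trans (map_comp_q_gen f' (MCtx.sub g' A) _)

theorem eqToHom_q_q_eq_id {f : X ⟶ Y} {g : Y ⟶ X} (h : f ≫ g = 𝟙 X) (A : X.Ty)
    (e : A = MCtx.sub f (MCtx.sub g A)) :
    eqToHom (congrArg X.ext e) ≫ MCtx.q f (MCtx.sub g A) ≫ MCtx.q g A = 𝟙 _ := by
  apply ext_hom_ext
  · rw [Category.assoc, Category.assoc, MCtx.q_proj, reassoc_of% MCtx.q_proj f, h,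
      Category.comp_id, Category.id_comp, eqToHom_proj e]
  · rw [map_id, Category.id_comp, ← Category.assoc]
    refine Eq.trans ?_ (map_eqToHom_gen e)
    exact (map_comp_q_gen g A _).trans (map_comp_q_gen f (MCtx.sub g A) _)

/-- The term given by an element of the total space of a type. -/
def mkTm (A : X.Ty) (a : obj X ⟶ (ty A).E) (h : a ≫ (ty A).p = (ty A).r) : MCtx.Tm A where
  hom := mkHom (Y := X.ext A) (𝟙 _)
    ((isPullback_gen A).lift a (𝟙 _) (h.trans (Category.id_comp _).symm)) (by
      refine (congrArg (_ ≫ ·) (disp_ext A)).trans ((Category.assoc _ _ _).symm.trans ?_)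
      refine (congrArg (· ≫ disp X) (IsPullback.lift_snd _ _ _ _)).trans ?_
      exact (Category.id_comp _).trans ((congrArg _ (F.map_id _)).trans (Category.comp_id _)).symm)
  hom_proj := by
    apply hom_ext
    · exact Category.comp_id _
    · rw [map_comp, map_mkHom, IsPullback.lift_snd, map_id]

theorem mkTm_gen (A : X.Ty) (a : obj X ⟶ (ty A).E) (h : a ≫ (ty A).p = (ty A).r) :
    map (mkTm A a h).hom ≫ gen A = a := by
  rw [mkTm, map_mkHom, IsPullback.lift_fst]

/-- A family of types indexed by a base type, as a classified family. -/
def family (hF : PreservesPullbacksAlongFib F) (I : X.BTy) (A : (X.weaken I).Ty) :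
    ClassifiedFamily (F.map (baseTy I).p) (ty A).V where
  base := obj X
  cls := disp X ≫ F.map (baseTy I).r
  tot := obj (X.weaken I)
  fst := disp (X.weaken I) ≫ F.map (baseTy I).gen
  snd := map (wproj X I)
  -- Weakening pulls back along `F` of a projection in `B`; `hF` makes that projection a pullback of
  -- `F.map (baseTy I).p`.
  isPullback := (isPullback_wproj X I).paste_horiz
    (hF _ _ _ _ (baseTy I).fib (baseTy I).isPullback_ext)
  ty := (ty A).r

/-- The morphism of classified families induced by a morphism of contexts. -/
def familyMap (hF : PreservesPullbacksAlongFib F) (f : X ⟶ Y) (I : Y.BTy)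
    (A : (Y.weaken I).Ty) :
    ClassifiedFamily.Hom (f := F.map (baseTy I).p) (V := (ty A).V)
      (family hF (bsub f I) (MCtx.sub (wmap f I) A)) (family hF I A) where
  base := map f
  tot := map (wmap f I)
  base_cls := map_disp_map f (baseTy I).r
  tot_fst := (map_disp_map (wmap f I) (baseTy I).gen).trans
    (congrArg (fun k => disp (X.weaken (bsub f I)) ≫ F.map k) (baseMap_wmap_gen f I))
  tot_snd := by
    have h : map (wmap f I) ≫ map (wproj Y I) = map (wproj X (bsub f I)) ≫ map f := by
      rw [← map_comp, ← map_comp, wmap_wproj]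
    exact h
  tot_ty := (r_sub (wmap f I) A).symm

end Underlying

/-! ### The formation rule -/

section Coproducts

open Underlying

variable [HasBinaryProducts C] (hF : PreservesPullbacksAlongFib F)
  {X Y : (changeOfBase F).MCtx}

/-- The coproduct of a family, classified by the generic coproduct. -/
def coproductTy {I : X.BTy} {A : (X.weaken I).Ty}
    (G : GenericCoproduct (F.map (baseTy I).p) (ty A).p) : X.Ty :=
  (⟨G.D.obj, G.tot, G.proj, G.fib, G.cls (family hF I A)⟩ : LUTy (obj X))

/-- The map from the total space of a family to the generic one. -/
def familyTot {I : X.BTy} {A : (X.weaken I).Ty}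
    (G : GenericCoproduct (F.map (baseTy I).p) (ty A).p) : obj ((X.weaken I).ext A) ⟶ G.fam :=
  G.famMap (family hF I A) (isPullback_gen A)

/-- The same `G` serves both sides, as substitution changes neither fibration; what remains is
naturality of the classifying map. -/
theorem coproductTy_sub (f : X ⟶ Y) {I : Y.BTy} {A : (Y.weaken I).Ty}
    (G : GenericCoproduct (F.map (baseTy I).p) (ty A).p) :
    MCtx.sub f (coproductTy hF G) =
      coproductTy (I := bsub f I) (A := MCtx.sub (wmap f I) A) hF G := by
  refine (ty_sub f (coproductTy hF G)).trans ?_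
  exact congrArg (LUTy.mk _ _ _ G.fib)
    (GenericCoproduct.base_cls (G := G) (familyMap hF f I A))

theorem map_q_familyTot (f : X ⟶ Y) {I : Y.BTy} {A : (Y.weaken I).Ty}
    (G : GenericCoproduct (F.map (baseTy I).p) (ty A).p) :
    map (MCtx.q (wmap f I) A) ≫ familyTot hF G =
      familyTot (I := bsub f I) (A := MCtx.sub (wmap f I) A) hF G := by
  refine GenericCoproduct.comp_famMap (G := G) _ (familyMap hF f I A) _ _
    (map_q_gen (wmap f I) A) ?_
  exact (map_comp _ _).symm.trans ((congrArg map (MCtx.q_proj (wmap f I) A)).trans (map_comp _ _))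

end Coproducts

end ChangeOfBase

section ChangeOfBase

variable {B : Type u₁} [Category.{v₁} B] [CatWithFib B] {C : Type u₂} [Category.{v₂} C]
  [CatWithFib C] {F : B ⥤ C}

open IndexedContextualCategory MCtx

namespace Underlying

variable {X Y : (changeOfBase F).MCtx}

/-- A type given by the components of a diagram in `C`. -/
def mkTy {V' E' : C} (p' : E' ⟶ V') (hp' : CatWithFib.fib p') (r : obj X ⟶ V') : X.Ty :=
  (LUTy.mk V' E' p' hp' r : LUTy (obj X))

/-- The generic element of the extension of a context by a type. -/
def genMk {V' E' : C} (p' : E' ⟶ V') (hp' : CatWithFib.fib p') (r : obj X ⟶ V') :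
    obj (X.ext (mkTy p' hp' r)) ⟶ E' :=
  gen (mkTy p' hp' r)

theorem genMk_p {V' E' : C} (p' : E' ⟶ V') (hp' : CatWithFib.fib p') (r : obj X ⟶ V') :
    genMk p' hp' r ≫ p' = map (MCtx.proj (mkTy p' hp' r)) ≫ r :=
  (isPullback_gen (mkTy p' hp' r)).w

theorem tm_q_proj {f : X ⟶ Y} {A : Y.Ty} (a : MCtx.Tm (MCtx.sub f A)) :
    (a.hom ≫ MCtx.q f A) ≫ MCtx.proj A = f := by
  rw [Category.assoc, MCtx.q_proj, reassoc_of% a.hom_proj]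

end Underlying

/-! ### The introduction rule and the generic injection -/

section Coproducts

open Underlying

variable [HasBinaryProducts C] (hF : PreservesPullbacksAlongFib F)
  {X Y : (changeOfBase F).MCtx}

theorem familyTot_incl_proj {I : X.BTy} {A : (X.weaken I).Ty}
    (G : GenericCoproduct (F.map (baseTy I).p) (ty A).p) :
    (familyTot hF G ≫ G.incl) ≫ G.proj =
      map (MCtx.proj A ≫ wproj X I) ≫ G.cls (family hF I A) := by
  rw [map_comp]
  exact G.famMap_incl_proj _ _

/-- The term interpreting the introduction rule. -/
def injTm {I : X.BTy} {A : (X.weaken I).Ty}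
    (G : GenericCoproduct (F.map (baseTy I).p) (ty A).p) (j : ContextualCategory.Tm I) :
    MCtx.Tm (MCtx.sub (MCtx.proj (MCtx.sub (X.inst j) A)) (coproductTy hF G)) :=
  mkTm _ (map (MCtx.q (X.inst j) A) ≫ familyTot hF G ≫ G.incl) (by
    refine Eq.trans ?_ (r_sub (MCtx.proj (MCtx.sub (X.inst j) A)) (coproductTy hF G)).symm
    refine (Category.assoc _ _ _).trans ((congrArg (_ ≫ ·) (familyTot_incl_proj hF G)).trans ?_)
    refine (Category.assoc _ _ _).symm.trans (congrArg (· ≫ G.cls (family hF I A)) ?_)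
    rw [← map_comp, reassoc_of% MCtx.q_proj, inst_wproj, Category.comp_id])

/-- The substitution of the interpretation of the introduction rule. -/
def injSub {I : X.BTy} {A : (X.weaken I).Ty}
    (G : GenericCoproduct (F.map (baseTy I).p) (ty A).p) (j : ContextualCategory.Tm I) :
    X.ext (MCtx.sub (X.inst j) A) ⟶ X.ext (coproductTy hF G) :=
  (injTm hF G j).hom ≫ MCtx.q (MCtx.proj _) _

theorem injSub_proj {I : X.BTy} {A : (X.weaken I).Ty}
    (G : GenericCoproduct (F.map (baseTy I).p) (ty A).p) (j : ContextualCategory.Tm I) :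
    injSub hF G j ≫ MCtx.proj (coproductTy hF G) = MCtx.proj (MCtx.sub (X.inst j) A) := by
  rw [injSub, Category.assoc, MCtx.q_proj, reassoc_of% (injTm hF G j).hom_proj]

theorem map_injSub {I : X.BTy} {A : (X.weaken I).Ty}
    (G : GenericCoproduct (F.map (baseTy I).p) (ty A).p) (j : ContextualCategory.Tm I) :
    map (injSub hF G j) ≫ gen (coproductTy hF G) =
      map (MCtx.q (X.inst j) A) ≫ familyTot hF G ≫ G.incl :=
  (map_comp_q_gen _ _ _).trans (mkTm_gen _ _ _)

/-- The map of extensions by coproducts over a morphism of contexts. -/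
def coproductMap (f : X ⟶ Y) {I : Y.BTy} {A : (Y.weaken I).Ty}
    (G : GenericCoproduct (F.map (baseTy I).p) (ty A).p) :
    X.ext (coproductTy (I := bsub f I) (A := MCtx.sub (wmap f I) A) hF G) ⟶
      Y.ext (coproductTy hF G) :=
  eqToHom (congrArg X.ext (coproductTy_sub hF f G).symm) ≫ MCtx.q f (coproductTy hF G)

theorem coproductMap_proj (f : X ⟶ Y) {I : Y.BTy} {A : (Y.weaken I).Ty}
    (G : GenericCoproduct (F.map (baseTy I).p) (ty A).p) :
    coproductMap hF f G ≫ MCtx.proj (coproductTy hF G) = MCtx.proj _ ≫ f := by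
  rw [coproductMap, Category.assoc, MCtx.q_proj,
    reassoc_of% eqToHom_proj (coproductTy_sub hF f G).symm]

theorem map_coproductMap (f : X ⟶ Y) {I : Y.BTy} {A : (Y.weaken I).Ty}
    (G : GenericCoproduct (F.map (baseTy I).p) (ty A).p) :
    map (coproductMap hF f G) ≫ gen (coproductTy hF G) =
      gen (coproductTy (I := bsub f I) (A := MCtx.sub (wmap f I) A) hF G) :=
  (map_comp_q_gen f _ _).trans (map_eqToHom_gen (coproductTy_sub hF f G).symm)

/-- The map `k` leaves room for a transport, so that one computation serves both `injSub_sub` and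
`map_genericInj`. -/
theorem map_injSub_coproductMap (f : X ⟶ Y) {I : Y.BTy} {A : (Y.weaken I).Ty}
    (G : GenericCoproduct (F.map (baseTy I).p) (ty A).p)
    (j : ContextualCategory.Tm (bsub f I)) {Z : (changeOfBase F).MCtx}
    (k : Z ⟶ X.ext (MCtx.sub (X.inst j) (MCtx.sub (wmap f I) A))) :
    map (k ≫ injSub (I := bsub f I) (A := MCtx.sub (wmap f I) A) hF G j ≫
        coproductMap hF f G) ≫ gen (coproductTy hF G) =
      map (k ≫ MCtx.q (X.inst j) (MCtx.sub (wmap f I) A) ≫ MCtx.q (wmap f I) A) ≫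
        familyTot hF G ≫ G.incl := by
  rw [map_comp, map_comp, map_comp, map_comp, Category.assoc, Category.assoc, Category.assoc,
    Category.assoc, map_coproductMap]
  refine congrArg (map k ≫ ·) ?_
  refine (map_injSub (I := bsub f I) (A := MCtx.sub (wmap f I) A) hF G j).trans ?_
  refine congrArg (map (MCtx.q (X.inst j) (MCtx.sub (wmap f I) A)) ≫ ·) ?_
  rw [← map_q_familyTot, Category.assoc]

theorem injSub_sub (f : X ⟶ Y) {I : Y.BTy} {A : (Y.weaken I).Ty}
    (G : GenericCoproduct (F.map (baseTy I).p) (ty A).p) (j : ContextualCategory.Tm I) :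
    eqToHom (congrArg X.ext (sub_inst_wmap f A j)) ≫
      injSub (I := bsub f I) (A := MCtx.sub (wmap f I) A) hF G (j.sub f.base) ≫
        coproductMap hF f G =
    MCtx.q f (MCtx.sub (Y.inst j) A) ≫ injSub hF G j := by
  apply ext_hom_ext
  · rw [Category.assoc, Category.assoc, Category.assoc, coproductMap_proj,
      injSub_proj, MCtx.q_proj,
      reassoc_of% injSub_proj (I := bsub f I) (A := MCtx.sub (wmap f I) A) hF G (j.sub f.base),
      reassoc_of% eqToHom_proj (sub_inst_wmap f A j)]
  · rw [map_injSub_coproductMap, map_comp (MCtx.q f _), Category.assoc, map_injSub,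
      eqToHom_q_q (inst_wmap f j).symm A (sub_inst_wmap f A j), map_comp, Category.assoc]
    rfl

/-- The generic injection. -/
def genericInj {I : X.BTy} {A : (X.weaken I).Ty}
    (G : GenericCoproduct (F.map (baseTy I).p) (ty A).p) :
    (X.weaken I).ext A ⟶ X.ext (coproductTy hF G) :=
  eqToHom (congrArg (X.weaken I).ext (sub_inst_bvar A)) ≫
    injSub (I := bsub (wproj X I) I) (A := MCtx.sub (wmap (wproj X I) I) A) hF G (X.bvar I) ≫
      coproductMap hF (wproj X I) G

theorem genericInj_proj {I : X.BTy} {A : (X.weaken I).Ty}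
    (G : GenericCoproduct (F.map (baseTy I).p) (ty A).p) :
    genericInj hF G ≫ MCtx.proj (coproductTy hF G) = MCtx.proj A ≫ wproj X I := by
  rw [genericInj, Category.assoc, Category.assoc, coproductMap_proj,
    reassoc_of% injSub_proj (I := bsub (wproj X I) I) (A := MCtx.sub (wmap (wproj X I) I) A) hF G
      (X.bvar I), reassoc_of% eqToHom_proj (sub_inst_bvar A)]

/-- Weakening and then instantiating at the variable is the identity (`inst_bvar`), which leaves the
pullback of the generic trivial cofibration. -/
theorem map_genericInj {I : X.BTy} {A : (X.weaken I).Ty}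
    (G : GenericCoproduct (F.map (baseTy I).p) (ty A).p) :
    map (genericInj hF G) ≫ gen (coproductTy hF G) = familyTot hF G ≫ G.incl := by
  rw [genericInj, map_injSub_coproductMap,
    eqToHom_q_q_eq_id (inst_bvar X I) A (sub_inst_bvar A), map_id, Category.id_comp]

/-- Injection at `j` is the injection at the variable instantiated at `j`; this reduces the
computation rule to `genericInj_elimTm`. -/
theorem injSub_eq {I : X.BTy} {A : (X.weaken I).Ty}
    (G : GenericCoproduct (F.map (baseTy I).p) (ty A).p) (j : ContextualCategory.Tm I) :
    injSub hF G j = MCtx.q (X.inst j) A ≫ genericInj hF G := by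
  apply ext_hom_ext
  · rw [injSub_proj, Category.assoc, genericInj_proj, reassoc_of% MCtx.q_proj (X.inst j),
      inst_wproj, Category.comp_id]
  · rw [map_injSub, map_comp, Category.assoc, map_genericInj]
    rfl

/-! ### Elimination -/

variable {V' E' : C} (p' : E' ⟶ V') (hp' : CatWithFib.fib p')

/-- The elimination problem given by a type over a coproduct and a term over the family. -/
def elimProblem {I : X.BTy} {A : (X.weaken I).Ty}
    (G : GenericCoproduct (F.map (baseTy I).p) (ty A).p)
    (r : obj (X.ext (coproductTy hF G)) ⟶ V') (d : obj ((X.weaken I).ext A) ⟶ E')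
    (w : map (genericInj hF G) ≫ r = d ≫ p') : G.ElimProblem p' where
  base := obj X
  cls := G.cls (family hF I A)
  tot := obj (X.ext (coproductTy hF G))
  totMap := gen (coproductTy hF G)
  totProj := map (MCtx.proj (coproductTy hF G))
  isPullback_tot := isPullback_gen (coproductTy hF G)
  fam := obj ((X.weaken I).ext A)
  famMap := familyTot hF G
  famProj := map (MCtx.proj A ≫ wproj X I)
  isPullback_fam := by
    rw [map_comp]
    exact G.isPullback_famMap (family hF I A) (isPullback_gen A)
  incl := map (genericInj hF G)
  incl_totMap := map_genericInj hF G
  incl_totProj := by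
    rw [← map_comp, genericInj_proj]
  ty := r
  tm := d
  w := w

/-- The morphism of elimination problems induced by a morphism of contexts. -/
def elimProblemMap (f : X ⟶ Y) {I : Y.BTy} {A : (Y.weaken I).Ty}
    (G : GenericCoproduct (F.map (baseTy I).p) (ty A).p)
    {r : obj (Y.ext (coproductTy hF G)) ⟶ V'} {d : obj ((Y.weaken I).ext A) ⟶ E'}
    (w : map (genericInj hF G) ≫ r = d ≫ p')
    {r' : obj (X.ext (coproductTy (I := bsub f I) (A := MCtx.sub (wmap f I) A) hF G)) ⟶ V'}
    {d' : obj ((X.weaken (bsub f I)).ext (MCtx.sub (wmap f I) A)) ⟶ E'}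
    (w' : map (genericInj (I := bsub f I) (A := MCtx.sub (wmap f I) A) hF G) ≫ r' = d' ≫ p')
    (hr : map (coproductMap hF f G) ≫ r = r') (hd : map (MCtx.q (wmap f I) A) ≫ d = d') :
    GenericCoproduct.ElimProblem.Hom (G := G)
      (elimProblem (I := bsub f I) (A := MCtx.sub (wmap f I) A) hF p' G r' d' w')
      (elimProblem hF p' G r d w) where
  base := map f
  tot := map (coproductMap hF f G)
  fam := map (MCtx.q (wmap f I) A)
  base_cls := GenericCoproduct.base_cls (G := G) (familyMap hF f I A)
  tot_totMap := map_coproductMap hF f G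
  tot_totProj := (map_comp _ _).symm.trans
    ((congrArg map (coproductMap_proj hF f G)).trans (map_comp _ _))
  fam_famMap := map_q_familyTot hF f G
  fam_famProj := by
    have h : map (MCtx.q (wmap f I) A) ≫ map (MCtx.proj A ≫ wproj Y I) =
        map (MCtx.proj (MCtx.sub (wmap f I) A) ≫ wproj X (bsub f I)) ≫ map f := by
      rw [← map_comp, ← map_comp, reassoc_of% MCtx.q_proj (wmap f I), wmap_wproj, Category.assoc]
    exact h
  tot_ty := hr
  fam_tm := hd

theorem elimTm_aux {I : X.BTy} {A : (X.weaken I).Ty}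
    (G : GenericCoproduct (F.map (baseTy I).p) (ty A).p)
    (r : obj (X.ext (coproductTy hF G)) ⟶ V')
    (d : MCtx.Tm (MCtx.sub (genericInj hF G) (mkTy p' hp' r))) :
    map (genericInj hF G) ≫ r =
      (map (d.hom ≫ MCtx.q (genericInj hF G) (mkTy p' hp' r)) ≫ genMk p' hp' r) ≫ p' := by
  rw [Category.assoc, genMk_p, ← Category.assoc, ← map_comp, tm_q_proj]

/-- The term interpreting the elimination rule. -/
def elimTm {I : X.BTy} {A : (X.weaken I).Ty}
    (G : GenericCoproduct (F.map (baseTy I).p) (ty A).p)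
    (S : GenericCoproduct.ElimProblem.Solutions G p')
    (r : obj (X.ext (coproductTy hF G)) ⟶ V')
    (d : MCtx.Tm (MCtx.sub (genericInj hF G) (mkTy p' hp' r))) : MCtx.Tm (mkTy p' hp' r) :=
  mkTm (mkTy p' hp' r) (S.sol (elimProblem hF p' G r _ (elimTm_aux hF p' hp' G r d)))
    (S.sol_comp _)

theorem map_elimTm {I : X.BTy} {A : (X.weaken I).Ty}
    (G : GenericCoproduct (F.map (baseTy I).p) (ty A).p)
    (S : GenericCoproduct.ElimProblem.Solutions G p')
    (r : obj (X.ext (coproductTy hF G)) ⟶ V')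
    (d : MCtx.Tm (MCtx.sub (genericInj hF G) (mkTy p' hp' r))) :
    map (elimTm hF p' hp' G S r d).hom ≫ genMk p' hp' r =
      S.sol (elimProblem hF p' G r _ (elimTm_aux hF p' hp' G r d)) :=
  mkTm_gen _ _ _

theorem genericInj_elimTm {I : X.BTy} {A : (X.weaken I).Ty}
    (G : GenericCoproduct (F.map (baseTy I).p) (ty A).p)
    (S : GenericCoproduct.ElimProblem.Solutions G p')
    (r : obj (X.ext (coproductTy hF G)) ⟶ V')
    (d : MCtx.Tm (MCtx.sub (genericInj hF G) (mkTy p' hp' r))) :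
    genericInj hF G ≫ (elimTm hF p' hp' G S r d).hom =
      d.hom ≫ MCtx.q (genericInj hF G) (mkTy p' hp' r) := by
  apply ext_hom_ext
  · rw [Category.assoc, Tm.hom_proj, tm_q_proj, Category.comp_id]
  · rw [map_comp, Category.assoc]
    exact (congrArg (map (genericInj hF G) ≫ ·) (map_elimTm hF p' hp' G S r d)).trans
      (S.incl_sol (elimProblem hF p' G r _ (elimTm_aux hF p' hp' G r d)))

theorem injSub_elimTm {I : X.BTy} {A : (X.weaken I).Ty}
    (G : GenericCoproduct (F.map (baseTy I).p) (ty A).p)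
    (S : GenericCoproduct.ElimProblem.Solutions G p')
    (r : obj (X.ext (coproductTy hF G)) ⟶ V')
    (d : MCtx.Tm (MCtx.sub (genericInj hF G) (mkTy p' hp' r)))
    (j : ContextualCategory.Tm I) :
    injSub hF G j ≫ (elimTm hF p' hp' G S r d).hom =
      MCtx.q (X.inst j) A ≫ d.hom ≫ MCtx.q (genericInj hF G) (mkTy p' hp' r) := by
  rw [injSub_eq, Category.assoc, genericInj_elimTm]

/-- This is naturality of the chosen solutions along `elimProblemMap`. The map `r'` and the
canonical map `k` are kept general because the substituted type agrees with the composite `r'` only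
up to associativity. -/
theorem elimTm_sub (f : X ⟶ Y) {I : Y.BTy} {A : (Y.weaken I).Ty}
    (G : GenericCoproduct (F.map (baseTy I).p) (ty A).p)
    (S : GenericCoproduct.ElimProblem.Solutions G p')
    (r : obj (Y.ext (coproductTy hF G)) ⟶ V')
    (d : MCtx.Tm (MCtx.sub (genericInj hF G) (mkTy p' hp' r)))
    (r' : obj (X.ext (coproductTy (I := bsub f I) (A := MCtx.sub (wmap f I) A) hF G)) ⟶ V')
    (hr : map (coproductMap hF f G) ≫ r = r')
    (d' : MCtx.Tm (MCtx.sub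
      (genericInj (I := bsub f I) (A := MCtx.sub (wmap f I) A) hF G) (mkTy p' hp' r')))
    (k : (X.ext (coproductTy (I := bsub f I) (A := MCtx.sub (wmap f I) A) hF G)).ext
      (mkTy p' hp' r') ⟶ (Y.ext (coproductTy hF G)).ext (mkTy p' hp' r))
    (hk : k ≫ MCtx.proj (mkTy p' hp' r) = MCtx.proj (mkTy p' hp' r') ≫ coproductMap hF f G)
    (hk' : map k ≫ genMk p' hp' r = genMk p' hp' r')
    (h : (d'.hom ≫ MCtx.q (genericInj (I := bsub f I) (A := MCtx.sub (wmap f I) A) hF G)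
        (mkTy p' hp' r')) ≫ k =
      MCtx.q (wmap f I) A ≫ d.hom ≫ MCtx.q (genericInj hF G) (mkTy p' hp' r)) :
    (elimTm (I := bsub f I) (A := MCtx.sub (wmap f I) A) hF p' hp' G S r' d').hom ≫ k =
      coproductMap hF f G ≫ (elimTm hF p' hp' G S r d).hom := by
  apply ext_hom_ext
  · rw [Category.assoc, Category.assoc, hk, Tm.hom_proj, Category.comp_id]
    exact (Category.assoc _ _ _).symm.trans ((congrArg (· ≫ coproductMap hF f G)
      (Tm.hom_proj _)).trans (Category.id_comp _))
  -- Read on generic elements, the hypothesis that `d'` is the substitution of `d` becomes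
  -- compatibility of the terms of the two elimination problems.
  · have hd : map (MCtx.q (wmap f I) A) ≫
        map (d.hom ≫ MCtx.q (genericInj hF G) (mkTy p' hp' r)) ≫ genMk p' hp' r =
        map (d'.hom ≫ MCtx.q (genericInj (I := bsub f I) (A := MCtx.sub (wmap f I) A) hF G)
          (mkTy p' hp' r')) ≫ genMk p' hp' r' := by
      rw [← hk', ← Category.assoc, ← map_comp, ← h, map_comp _ k, Category.assoc]
    rw [map_comp, map_comp, Category.assoc, Category.assoc]
    refine (congrArg (_ ≫ ·) hk').trans ?_
    refine (map_elimTm (I := bsub f I) (A := MCtx.sub (wmap f I) A) hF p' hp' G S r' d').trans ?_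
    refine Eq.trans ?_ (congrArg (map (coproductMap hF f G) ≫ ·)
      (map_elimTm hF p' hp' G S r d)).symm
    exact (S.hom_sol (elimProblemMap hF p' f G _ _ hr hd)).symm

end Coproducts

end ChangeOfBase

/-! ### Assembly of the rules from global choices -/

section ChangeOfBase

variable {B : Type u₁} [Category.{v₁} B] [CatWithFib B] {C : Type u₂} [Category.{v₂} C]
  {F : B ⥤ C}

theorem IsFFibration.of_isPullback {X Y E V : C} {g : E ⟶ V} {f : X ⟶ Y}
    {t : X ⟶ E} {b : Y ⟶ V} (h : IsPullback t f g b) (hg : IsFFibration F g) :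
    IsFFibration F f := by
  obtain ⟨E', V', p, t', b', hp, h'⟩ := hg
  exact ⟨E', V', p, t ≫ t', b ≫ b', hp, h.paste_horiz h'⟩

theorem isFFibration_map {E V : B} {p : E ⟶ V} (hp : CatWithFib.fib p) :
    IsFFibration F (F.map p) :=
  ⟨E, V, p, 𝟙 _, 𝟙 _, hp, IsPullback.of_id_fst⟩

variable [CatWithFib C]

open IndexedContextualCategory MCtx Underlying

variable [HasBinaryProducts C] (hF : PreservesPullbacksAlongFib F)

/-- Formation and introduction from a choice of generic coproducts. -/
def coproductFormation
    (G : ∀ {E V : B} {p : E ⟶ V} {E' V' : C} {p' : E' ⟶ V'},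
      CatWithFib.fib p → CatWithFib.fib p' → GenericCoproduct (F.map p) p') :
    CoproductFormation (changeOfBase F) where
  -- The choice depends on the two fibrations alone and not on the context or the classifying maps,
  -- so it is unchanged by substitution.
  coprod _ I A := coproductTy hF (G (baseTy I).fib (ty A).fib)
  coprod_sub f I A := coproductTy_sub hF f (G (baseTy I).fib (ty A).fib)
  inj {_ I} A j := injTm hF (G (baseTy I).fib (ty A).fib) j
  inj_sub {_ _} f {I} A j := injSub_sub hF f (G (baseTy I).fib (ty A).fib) j

attribute [local irreducible] LUTy.ext LUTy.proj IsPullback.lift Tel.pull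

variable (G : ∀ {E V : B} {p : E ⟶ V} {E' V' : C} {p' : E' ⟶ V'},
      CatWithFib.fib p → CatWithFib.fib p' → GenericCoproduct (F.map p) p')
    (S : ∀ {E V : B} {p : E ⟶ V} {E' V' : C} {p' : E' ⟶ V'} (hp : CatWithFib.fib p)
      (hp' : CatWithFib.fib p') {E'' V'' : C} {p'' : E'' ⟶ V''}, CatWithFib.fib p'' →
      GenericCoproduct.ElimProblem.Solutions (G hp hp') p'')

/-- Elimination from a choice of generic coproducts and natural solutions of the elimination
problems. -/
def coproductElim {X : (changeOfBase F).MCtx} {I : X.BTy} {A : (X.weaken I).Ty}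
    (D : (X.ext ((coproductFormation hF G).coprod X I A)).Ty)
    (d : MCtx.Tm (MCtx.sub ((coproductFormation hF G).genInj A) D)) : MCtx.Tm D :=
  elimTm hF (ty D).p (ty D).fib (G (baseTy I).fib (ty A).fib)
    (S (baseTy I).fib (ty A).fib (ty D).fib) (ty D).r d

set_option maxHeartbeats 4000000 in
/-- Stable dependent coproducts from a choice of generic coproducts and natural solutions of the
elimination problems. -/
def stableDependentCoproducts : StableDependentCoproducts (changeOfBase F) :=
  .mk (coproductFormation hF G) (coproductElim hF G S)
    (fun {_ I A} D d j => injSub_elimTm hF (ty D).p (ty D).fib (G (baseTy I).fib (ty A).fib)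
      (S (baseTy I).fib (ty A).fib (ty D).fib) (ty D).r d j)
    (by
      intro X Y f I A D d d' h
      rw [← Category.assoc] at h
      rcases D with ⟨V', E', p', hp', r⟩
      exact elimTm_sub hF p' hp' f (G (baseTy I).fib (ty A).fib)
        (S (baseTy I).fib (ty A).fib hp') r d _
        (r_sub (coproductMap hF f (G (baseTy I).fib (ty A).fib)) (mkTy p' hp' r)).symm d'
        (MCtx.q (coproductMap hF f (G (baseTy I).fib (ty A).fib)) (mkTy p' hp' r))
        (MCtx.q_proj _ _) (map_q_gen _ _) h)

end ChangeOfBase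

end IndexedTT

end

theorem mainTheorem10 {B : Type u₁} [Category.{v₁} B] [IndexedTT.CatWithFib B]
    {C : Type u₂} [Category.{v₂} C] [IndexedTT.CatWithFib C] [HasBinaryProducts C] (F : B ⥤ C)
    (hF : IndexedTT.PreservesPullbacksAlongFib F)
    (hpull : ∀ ⦃X Y : C⦄ (g : X ⟶ Y), IndexedTT.IsFFibration F g → HasPullbacksAlong g)
    (hexp : ∀ ⦃X Y : C⦄ (p : X ⟶ Y), IndexedTT.CatWithFib.fib p → IndexedTT.Exponentiable p)
    (hexpF : ∀ ⦃X Y : C⦄ (g : X ⟶ Y), IndexedTT.IsFFibration F g → IndexedTT.Exponentiable g)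
    (hquasi : ∀ ⦃X Y Z : C⦄ (q : X ⟶ Y) (p : Y ⟶ Z), IndexedTT.CatWithFib.fib q →
      IndexedTT.IsFFibration F p → IndexedTT.IsQuasifibration (q ≫ p)) :
    IndexedTT.HasStableDependentCoproducts (IndexedTT.changeOfBase F) := by
  have hfib : ∀ ⦃X Y : C⦄ (g : X ⟶ Y), IndexedTT.CatWithFib.fib g →
      IndexedTT.HasDependentProductsAlong g := fun _ _ g hg =>
    (hexp g hg).hasDependentProductsAlong
  have hffib : ∀ {E V : B} {p : E ⟶ V}, IndexedTT.CatWithFib.fib p → ∀ ⦃X Y : C⦄ (g : X ⟶ Y)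
      (t : X ⟶ F.obj E) (b : Y ⟶ F.obj V), IsPullback t g (F.map p) b →
      IndexedTT.HasDependentProductsAlong g := fun hp _ _ g _ _ h =>
    (hexpF g (.of_isPullback h (IndexedTT.isFFibration_map hp))).hasDependentProductsAlong
  have hG : ∀ {E V : B} {p : E ⟶ V} {E' V' : C} {p' : E' ⟶ V'}, IndexedTT.CatWithFib.fib p →
      IndexedTT.CatWithFib.fib p' → Nonempty (IndexedTT.GenericCoproduct (F.map p) p') :=
    fun {E V p E' V' p'} hp hp' =>
      -- The identity square presents `F.map p` as a pullback of itself.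
      IndexedTT.exists_genericCoproduct hp' (hffib hp _ _ _ IsPullback.of_id_fst)
        (fun X Y Z q g t b hq h =>
          hquasi q g hq (.of_isPullback h (IndexedTT.isFFibration_map hp)))
  exact ⟨IndexedTT.stableDependentCoproducts hF (fun hp hp' => Classical.choice (hG hp hp'))
    (fun hp hp' _ _ _ hp'' => Classical.choice
      (IndexedTT.GenericCoproduct.ElimProblem.exists_solutions hp' hp'' hfib (hffib hp)))⟩
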